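/- Let $d\geq 1$, let $\langle\cdot;\cdot\rangle$ and $\|\cdot\|$ be the Euclidean inner product and norm on $\mathbb R^d$, and let $\mathcal S(\mathbb R^d)$ be the space of real-valued Schwartz functions on $\mathbb R^d$. A Lévy measure is a positive Borel measure $\nu$ on $\mathbb R^d$ with $\nu(\{0\})=0$ and $\int_{\mathbb R^d}(1\wedge\|u\|^2)\,\nu(du)<+\infty$. A random vector $X$ in $\mathbb R^d$ is called stable with parameter $b\in\mathbb R^d$, stability index $\alpha\in(0,2)$ and Lévy measure $\nu$ if, for all $\xi\in\mathbb R^d$, $$\mathbb E\, e^{i\langle\xi;X\rangle}=\exp\left(i\langle b;\xi\rangle+\int_{\mathbb R^d}\left(e^{i\langle\xi;u\rangle}-1-i\langle\xi;u\rangle\mathbf 1_{\|u\|\leq 1}\right)\nu(du)\right)$$ and $\nu(du)=\mathbf 1_{(0,+\infty)}(r)\,\mathbf 1_{\mathbb S^{d-1}}(x)\,\frac{dr}{r^{\alpha+1}}\,\sigma(dx)$ in polar coordinates $u=rx$, for some finite positive measure $\sigma$ on the unit sphere $\mathbb S^{d-1}$. **Theorem.** Let $X$ be a random vector in $\mathbb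 R^d$, let $b\in\mathbb R^d$, and let $\nu$ be a Lévy measure on $\mathbb R^d$ such that $\nu(B)=c^{-1}\nu(B/c)$ for all $c>0$ and all Borel sets $B\subset\mathbb R^d$. Let $\sigma$ be the spherical part of $\nu$, i.e., the finite measure on $\mathbb S^{d-1}$ given by $\sigma(A)=\nu\left(\{u:\ \|u\|>1,\ u/\|u\|\in A\}\right)$, which is the $\sigma$ of the polar decomposition $\nu(du)=\mathbf 1_{(0,+\infty)}(r)\,\mathbf 1_{\mathbb S^{d-1}}(x)\,\frac{dr}{r^{2}}\,\sigma(dx)$, and assume that $$\int_{\mathbb S^{d-1}}x\,\sigma(dx)=0.$$ Then $$\mathbb E\langle X;\nabla f(X)\rangle=\mathbb E\langle b;\nabla f(X)\rangle+\mathbb E\int_{\mathbb R^d}\left(f(X+u)-f(X)-\langle\nabla f(X);u\rangle\mathbf 1_{\|u\|\leq 1}\right)\nu(du)$$ for all $f\in\mathcal S(\mathbb R^d)$ if and only if $X$ is a stable random vector with parameter $b$, stability index $\alpha=1$ and Lévy measure $\nu$. -/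

import Mathlib

open MeasureTheory Set
open scoped RealInnerProductSpace ENNReal SchwartzMap Matrix

noncomputable section

/-- A Lévy measure on `ℝ^d`: a Borel measure `ν` with `ν {0} = 0` and
`∫ (1 ∧ ‖u‖²) ν(du) < ∞`. -/
structure IsLevyMeasure {d : ℕ} (ν : Measure (EuclideanSpace ℝ (Fin d))) : Prop where
  zero_singleton : ν {0} = 0
  lintegral_lt_top : ∫⁻ u, ENNReal.ofReal (min 1 (‖u‖ ^ 2)) ∂ν < ∞

/-- The dilation `T_c ν`, i.e. `(T_c ν)(B) = ν (B / c) = ν {u | c u ∈ B}` for `c > 0`. -/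
def dilation {d : ℕ} (c : ℝ) (ν : Measure (EuclideanSpace ℝ (Fin d))) :
    Measure (EuclideanSpace ℝ (Fin d)) :=
  ν.map (fun u => c • u)

/-- The exponent `i⟨b, ξ⟩ - ⟨ξ, S ξ⟩ / 2 + ∫ (e^{i⟨ξ, u⟩} - 1 - i⟨ξ, u⟩ 1_{‖u‖ ≤ 1}) ν(du)`
of the Lévy-Khintchine representation. -/
def levyExponent {d : ℕ} (b : EuclideanSpace ℝ (Fin d)) (S : Matrix (Fin d) (Fin d) ℝ)
    (ν : Measure (EuclideanSpace ℝ (Fin d))) (ξ : EuclideanSpace ℝ (Fin d)) : ℂ :=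
  Complex.I * (⟪b, ξ⟫ : ℝ) - (1 / 2 : ℂ) * ((ξ.ofLp ⬝ᵥ (S *ᵥ ξ.ofLp) : ℝ) : ℂ)
    + ∫ u, (Complex.exp (Complex.I * (⟪ξ, u⟫ : ℝ)) - 1
        - Complex.I * ((Metric.closedBall (0 : EuclideanSpace ℝ (Fin d)) 1).indicator
            (fun v => ⟪ξ, v⟫) u : ℝ)) ∂ν

/-- `μ` is the infinitely divisible law with generating triplet `(b, S, ν)`. -/
structure IsInfinitelyDivisibleLaw {d : ℕ} (μ : Measure (EuclideanSpace ℝ (Fin d)))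
    (b : EuclideanSpace ℝ (Fin d)) (S : Matrix (Fin d) (Fin d) ℝ)
    (ν : Measure (EuclideanSpace ℝ (Fin d))) : Prop where
  isProbabilityMeasure : IsProbabilityMeasure μ
  posSemidef : S.PosSemidef
  isLevyMeasure : IsLevyMeasure ν
  charFun_eq : ∀ ξ, charFun μ ξ = Complex.exp (levyExponent b S ν ξ)

/-- The measure `1_{(0, ∞)}(r) 1_{sphere}(x) r^{-(α + 1)} dr σ(dx)` on `ℝ^d`, in polar
coordinates `u = r x`. -/
def polarMeasure {d : ℕ} (α : ℝ)
    (σ : Measure (Metric.sphere (0 : EuclideanSpace ℝ (Fin d)) 1)) :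
    Measure (EuclideanSpace ℝ (Fin d)) :=
  (σ.prod ((volume.restrict (Ioi (0 : ℝ))).withDensity
    (fun r => ENNReal.ofReal (r ^ (-(α + 1)))))).map
      (fun p => p.2 • (p.1 : EuclideanSpace ℝ (Fin d)))

/-- `μ` is the `α`-stable law, `0 < α < 2`, with parameter `b` and Lévy measure `ν`:
it is infinitely divisible with triplet `(b, 0, ν)`, and `ν` has the polar decomposition
`r^{-(α + 1)} dr σ(dx)` for some finite measure `σ` on the unit sphere. -/
structure IsStableLaw {d : ℕ} (μ : Measure (EuclideanSpace ℝ (Fin d))) (α : ℝ)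
    (b : EuclideanSpace ℝ (Fin d)) (ν : Measure (EuclideanSpace ℝ (Fin d))) : Prop where
  index_mem : α ∈ Ioo (0 : ℝ) 2
  isInfinitelyDivisible : IsInfinitelyDivisibleLaw μ b 0 ν
  exists_polar : ∃ σ : Measure (Metric.sphere (0 : EuclideanSpace ℝ (Fin d)) 1),
    IsFiniteMeasure σ ∧ ν = polarMeasure α σ

/-- The spherical part of a measure `ν` with `ν = c^{-α} T_c ν` for all `c > 0`: the measure
`σ(B) = α ν {u | 1 < ‖u‖, u / ‖u‖ ∈ B}` on the unit sphere. By `sphericalPart_polarMeasure`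
it is the `σ` of the polar decomposition `ν(du) = r^{-(α + 1)} dr σ(dx)`. -/
def sphericalPart {d : ℕ} (α : ℝ) (ν : Measure (EuclideanSpace ℝ (Fin d))) :
    Measure (Metric.sphere (0 : EuclideanSpace ℝ (Fin d)) 1) :=
  ENNReal.ofReal α • ((ν.restrict {u | 1 < ‖u‖}).map (fun u => ‖u‖⁻¹ • u)).comap Subtype.val

theorem sphericalPart_polarMeasure {d : ℕ} {α : ℝ} (hα : 0 < α)
    (σ : Measure (Metric.sphere (0 : EuclideanSpace ℝ (Fin d)) 1)) [IsFiniteMeasure σ] :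
    sphericalPart α (polarMeasure α σ) = σ := by
  have hm : Measurable (fun p : Metric.sphere (0 : EuclideanSpace ℝ (Fin d)) 1 × ℝ =>
      p.2 • (p.1 : EuclideanSpace ℝ (Fin d))) := by fun_prop
  have hn : Measurable (fun u : EuclideanSpace ℝ (Fin d) => ‖u‖⁻¹ • u) := by fun_prop
  have hemb : MeasurableEmbedding
      (Subtype.val : Metric.sphere (0 : EuclideanSpace ℝ (Fin d)) 1 → _) :=
    MeasurableEmbedding.subtype_coe Metric.isClosed_sphere.measurableSet
  have hs : MeasurableSet {u : EuclideanSpace ℝ (Fin d) | 1 < ‖u‖} :=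
    measurableSet_lt measurable_const measurable_norm
  ext B hB
  set ρ : Measure ℝ := (volume.restrict (Ioi (0 : ℝ))).withDensity
    (fun r => ENNReal.ofReal (r ^ (-(α + 1)))) with hρ
  have hρ0 : ρ (Iic 0) = 0 := by
    rw [hρ, withDensity_apply _ measurableSet_Iic, Measure.restrict_restrict measurableSet_Iic,
      Iic_inter_Ioi, Ioc_self, Measure.restrict_empty, lintegral_zero_measure]
  have hρ1 : ρ (Ioi 1) = (ENNReal.ofReal α)⁻¹ := by
    rw [hρ, withDensity_apply _ measurableSet_Ioi, Measure.restrict_restrict measurableSet_Ioi,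
      inter_eq_left.2 (Ioi_subset_Ioi zero_le_one),
      ← ofReal_integral_eq_lintegral_ofReal
        (integrableOn_Ioi_rpow_of_lt (by linarith) one_pos),
      integral_Ioi_rpow_of_lt (by linarith) one_pos, ← ENNReal.ofReal_inv_of_pos hα]
    · congr 1
      rw [Real.one_rpow, show -(α + 1) + 1 = -α by ring, neg_div_neg_eq, one_div]
    · filter_upwards [ae_restrict_mem measurableSet_Ioi] with r hr
      exact Real.rpow_nonneg (zero_le_one.trans (le_of_lt hr)) _
  have hB' := hemb.measurableSet_image.2 hB
  rw [sphericalPart, Measure.smul_apply, hemb.comap_apply, Measure.map_apply hn hB',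
    Measure.restrict_apply (hn hB'), polarMeasure, ← hρ,
    Measure.map_apply hm ((hn hB').inter hs)]
  have key : (σ.prod ρ) ((fun p : Metric.sphere (0 : EuclideanSpace ℝ (Fin d)) 1 × ℝ =>
      p.2 • (p.1 : EuclideanSpace ℝ (Fin d))) ⁻¹'
        ((fun u => ‖u‖⁻¹ • u) ⁻¹' (Subtype.val '' B) ∩ {u | 1 < ‖u‖}))
      = (σ.prod ρ) (B ×ˢ Ioi 1) := by
    apply measure_congr
    have h0 : ∀ᵐ p ∂(σ.prod ρ), p.2 ∉ Iic (0 : ℝ) := by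
      rw [ae_iff]
      have : {p : Metric.sphere (0 : EuclideanSpace ℝ (Fin d)) 1 × ℝ | ¬ p.2 ∉ Iic (0 : ℝ)}
          = univ ×ˢ Iic 0 := by ext p; simp
      rw [this, Measure.prod_prod, hρ0, mul_zero]
    filter_upwards [h0] with p hp
    have hp : 0 < p.2 := by simpa using hp
    have hx : ‖(p.1 : EuclideanSpace ℝ (Fin d))‖ = 1 := by simp
    apply propext
    change (_ ∧ _) ↔ (_ ∧ _)
    have e1 : ‖p.2 • (p.1 : EuclideanSpace ℝ (Fin d))‖ = p.2 := by
      rw [norm_smul, hx, mul_one, Real.norm_of_nonneg hp.le]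
    refine and_congr ?_ ?_
    · simp only [mem_preimage, e1, smul_smul, inv_mul_cancel₀ hp.ne', one_smul]
      exact Subtype.val_injective.mem_set_image
    · simp only [mem_ofPred_eq, e1, mem_Ioi]
  rw [key, Measure.prod_prod, hρ1, smul_eq_mul, mul_comm (σ B), ← mul_assoc,
    ENNReal.mul_inv_cancel (by simpa using hα) ENNReal.ofReal_ne_top, one_mul]

/-- The non-local term
`∫ (f (x + u) - f x - ⟨∇f x, u⟩ 1_{‖u‖ ≤ 1}) ν(du)`. -/
def nonlocalTerm {d : ℕ} (ν : Measure (EuclideanSpace ℝ (Fin d)))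
    (f : 𝓢(EuclideanSpace ℝ (Fin d), ℝ)) (x : EuclideanSpace ℝ (Fin d)) : ℝ :=
  ∫ u, (f (x + u) - f x
    - (Metric.closedBall (0 : EuclideanSpace ℝ (Fin d)) 1).indicator
        (fun v => ⟪gradient f x, v⟫) u) ∂ν

end

/-! Write `A` for the generator with drift `b` and jump measure `ν`. Since `ν` is homogeneous with
index 1 and `σ` is centred, changing the truncation radius costs nothing, so `A (g(t·))(x) = t (A
g)(t x)` (`levyGenerator_comp_smul`). The exponentials `e_ξ` are eigenfunctions of `A`, with
eigenvalue the Lévy-Khintchine exponent `ψ(ξ)`, hence `ψ(t ξ) = t ψ(ξ)` for `t > 0`. Stein implies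
stable: the Stein equation for `g(r·)` says `d/dr E g(rX) = E (A g)(rX)`. Integrated over `[0, t]`,
it no longer contains `⟨x, ∇g⟩`, so cutoffs extend it from Schwartz functions to `e_ξ`. There it
reads `φ(t) = 1 + ψ ∫₀ᵗ φ` for `φ(t) = E e_ξ(tX)`, so `φ(1) = e^ψ` (`charFun_eq_of_stein`). Stable
implies Stein: Fourier inversion and homogeneity give `E g(tX) = ∫ e^{tψ(2πξ)} ĝ(ξ) dξ`.
Differentiating both sides at `t = 1` gives `E ⟨X, ∇g(X)⟩` on the left and `E A g(X)` on the right,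
because `A` is the Fourier multiplier `ψ(2πξ)` (`stein_of_charFun_eq`). The polar decomposition of
`ν` (`eq_polarMeasure_sphericalPart`) turns the centring of `σ` into the vanishing of the truncation
terms. -/

/-! ### Polar decomposition of a 1-homogeneous Lévy measure. -/

/-- These half-lines all have finite mass for `r^{-2} dr` on `(0, ∞)`; the sets `Ioi a` with `a ≤ 0`
would not, which matters for uniqueness of the product measure. -/
theorem isPiSystem_Iic_Ioi :
    IsPiSystem ({s : Set ℝ | ∃ a ≤ 0, s = Iic a} ∪ {s | ∃ a > 0, s = Ioi a}) := by
  rintro _ (⟨a, ha, rfl⟩ | ⟨a, ha, rfl⟩) _ (⟨b, hb, rfl⟩ | ⟨b, hb, rfl⟩) hne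
  · exact Or.inl ⟨min a b, min_le_of_left_le ha, Iic_inter_Iic⟩
  · obtain ⟨x, hx1, hx2⟩ := hne
    simp only [mem_Iic, mem_Ioi] at hx1 hx2
    linarith
  · obtain ⟨x, hx1, hx2⟩ := hne
    simp only [mem_Iic, mem_Ioi] at hx1 hx2
    linarith
  · exact Or.inr ⟨max a b, lt_max_of_lt_left ha, Ioi_inter_Ioi⟩

theorem generateFrom_Iic_Ioi :
    MeasurableSpace.generateFrom
      ({s : Set ℝ | ∃ a ≤ 0, s = Iic a} ∪ {s | ∃ a > 0, s = Ioi a}) = borel ℝ := by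
  apply le_antisymm
  · apply MeasurableSpace.generateFrom_le
    rw [← BorelSpace.measurable_eq (α := ℝ)]
    rintro _ (⟨a, ha, rfl⟩ | ⟨a, ha, rfl⟩)
    · exact measurableSet_Iic
    · exact measurableSet_Ioi
  · rw [borel_eq_generateFrom_Ioi]
    apply MeasurableSpace.generateFrom_le
    rintro _ ⟨a, rfl⟩
    rcases le_or_gt a 0 with ha | ha
    · rw [← compl_Iic]
      exact (MeasurableSpace.measurableSet_generateFrom (Or.inl ⟨a, ha, rfl⟩)).compl
    · exact MeasurableSpace.measurableSet_generateFrom (Or.inr ⟨a, ha, rfl⟩)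

/-- The radial measure `1_{(0, ∞)}(r) r^{-2} dr`. -/
noncomputable def radialMeasure : Measure ℝ :=
  (volume.restrict (Ioi (0 : ℝ))).withDensity (fun r => ENNReal.ofReal (r ^ (-((1 : ℝ) + 1))))

theorem radialMeasure_Iic {a : ℝ} (ha : a ≤ 0) : radialMeasure (Iic a) = 0 := by
  rw [radialMeasure, withDensity_apply _ measurableSet_Iic,
    Measure.restrict_restrict measurableSet_Iic, Iic_inter_Ioi, Ioc_eq_empty (not_lt.2 ha),
    Measure.restrict_empty, lintegral_zero_measure]

theorem radialMeasure_Ioi {a : ℝ} (ha : 0 < a) : radialMeasure (Ioi a) = ENNReal.ofReal a⁻¹ := by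
  rw [radialMeasure, withDensity_apply _ measurableSet_Ioi,
    Measure.restrict_restrict measurableSet_Ioi, inter_eq_left.2 (Ioi_subset_Ioi ha.le),
    ← ofReal_integral_eq_lintegral_ofReal (integrableOn_Ioi_rpow_of_lt (by norm_num) ha),
    integral_Ioi_rpow_of_lt (by norm_num) ha]
  · congr 1
    rw [show (-((1 : ℝ) + 1) + 1) = -1 by norm_num, neg_div_neg_eq, div_one, Real.rpow_neg_one]
  · filter_upwards [ae_restrict_mem measurableSet_Ioi] with r hr
    exact Real.rpow_nonneg (ha.le.trans (le_of_lt hr)) _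

instance : SFinite radialMeasure := by unfold radialMeasure; infer_instance

section Polar

variable {d : ℕ} {ν : Measure (EuclideanSpace ℝ (Fin d))}

theorem IsLevyMeasure.measure_norm_gt_lt_top (hν : IsLevyMeasure ν) {r : ℝ} (hr : 0 < r) :
    ν {u | r < ‖u‖} < ∞ := by
  have hc : (0 : ℝ) < min 1 (r ^ 2) := by positivity
  have hc' : ENNReal.ofReal (min 1 (r ^ 2)) ≠ 0 := (ENNReal.ofReal_pos.2 hc).ne'
  refine lt_of_le_of_lt (measure_mono fun u hu => ?_)
    ((meas_ge_le_lintegral_div (μ := ν) (f := fun u => ENNReal.ofReal (min 1 (‖u‖ ^ 2)))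
      (by fun_prop) hc' ENNReal.ofReal_ne_top).trans_lt
      (ENNReal.div_lt_top hν.lintegral_lt_top.ne hc'))
  have hu' : r < ‖u‖ := hu
  exact ENNReal.ofReal_le_ofReal (min_le_min_left _ (by gcongr))

theorem IsLevyMeasure.integrable (hν : IsLevyMeasure ν) :
    Integrable (fun u => min 1 (‖u‖ ^ 2)) ν := by
  refine (lintegral_ofReal_ne_top_iff_integrable (by fun_prop) ?_).1 hν.lintegral_lt_top.ne
  exact Filter.Eventually.of_forall fun u => by positivity

theorem sphericalPart_apply {B : Set (Metric.sphere (0 : EuclideanSpace ℝ (Fin d)) 1)}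
    (hB : MeasurableSet B) :
    sphericalPart 1 ν B = ν {u | 1 < ‖u‖ ∧ ‖u‖⁻¹ • u ∈ Subtype.val '' B} := by
  have hn : Measurable (fun u : EuclideanSpace ℝ (Fin d) => ‖u‖⁻¹ • u) := by fun_prop
  have hemb : MeasurableEmbedding
      (Subtype.val : Metric.sphere (0 : EuclideanSpace ℝ (Fin d)) 1 → _) :=
    MeasurableEmbedding.subtype_coe Metric.isClosed_sphere.measurableSet
  have hB' := hemb.measurableSet_image.2 hB
  rw [sphericalPart, Measure.smul_apply, hemb.comap_apply, Measure.map_apply hn hB',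
    Measure.restrict_apply (hn hB'), ENNReal.ofReal_one, one_smul]
  congr 1
  ext u
  simp [and_comm]

theorem isFiniteMeasure_sphericalPart (hν : IsLevyMeasure ν) :
    IsFiniteMeasure (sphericalPart 1 ν) := by
  refine ⟨?_⟩
  rw [sphericalPart_apply MeasurableSet.univ]
  exact (measure_mono fun u hu => hu.1).trans_lt (hν.measure_norm_gt_lt_top one_pos)

/-- Scaling with `c = r`: a dilation moves the radius and keeps the direction. -/
theorem measure_cone_eq
    (hscale : ∀ c : ℝ, 0 < c → ν = ENNReal.ofReal c⁻¹ • dilation c ν)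
    {A : Set (EuclideanSpace ℝ (Fin d))} (hA : MeasurableSet A) {r : ℝ} (hr : 0 < r) :
    ν {u | r < ‖u‖ ∧ ‖u‖⁻¹ • u ∈ A}
      = ENNReal.ofReal r⁻¹ * ν {u | 1 < ‖u‖ ∧ ‖u‖⁻¹ • u ∈ A} := by
  have hn : Measurable (fun u : EuclideanSpace ℝ (Fin d) => ‖u‖⁻¹ • u) := by fun_prop
  have hm : MeasurableSet {u : EuclideanSpace ℝ (Fin d) | r < ‖u‖ ∧ ‖u‖⁻¹ • u ∈ A} :=
    (measurableSet_lt measurable_const measurable_norm).inter (hn hA)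
  conv_lhs => rw [hscale r hr]
  rw [Measure.smul_apply, dilation, Measure.map_apply (by fun_prop) hm, smul_eq_mul]
  congr 2
  ext u
  simp only [preimage_ofPred_eq, mem_ofPred_eq, norm_smul, Real.norm_of_nonneg hr.le, mul_inv,
    smul_smul]
  rw [show r⁻¹ * ‖u‖⁻¹ * r = ‖u‖⁻¹ by field_simp, lt_mul_iff_one_lt_right hr]

/-- A Lévy measure with `ν(B) = c⁻¹ ν(B / c)` has the polar decomposition `r^{-2} dr σ(dx)`. -/
theorem eq_polarMeasure_sphericalPart (hd : 1 ≤ d) (hν : IsLevyMeasure ν)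
    (hscale : ∀ c : ℝ, 0 < c → ν = ENNReal.ofReal c⁻¹ • dilation c ν) :
    ν = polarMeasure 1 (sphericalPart 1 ν) := by
  classical
  have := isFiniteMeasure_sphericalPart hν
  have : Nonempty (Fin d) := ⟨⟨0, hd⟩⟩
  obtain ⟨e, he⟩ : ∃ e : EuclideanSpace ℝ (Fin d), ‖e‖ = 1 := exists_norm_eq _ zero_le_one
  -- The value `e` at the origin is arbitrary; a unit vector exists because `1 ≤ d`.
  let θ (u : EuclideanSpace ℝ (Fin d)) : Metric.sphere (0 : EuclideanSpace ℝ (Fin d)) 1 :=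
    ⟨if u = 0 then e else ‖u‖⁻¹ • u, by
      by_cases h : u = 0
      · simp [h, he]
      · simp [h, norm_smul]⟩
  have hθ : Measurable θ := by
    refine Measurable.subtype_mk ?_
    exact Measurable.ite (measurableSet_singleton 0) measurable_const (by fun_prop)
  have hθu (u) (hu : 0 < ‖u‖) : (θ u : EuclideanSpace ℝ (Fin d)) = ‖u‖⁻¹ • u := by
    simp [θ, norm_pos_iff.1 hu]
  have hq : Measurable (fun u => (θ u, ‖u‖)) := hθ.prodMk measurable_norm
  -- It suffices to compare the masses of the sets `B × (a, ∞)` with `a > 0`, given by the scaling,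
  -- and of `B × (-∞, a]` with `a ≤ 0`, which are null.
  have key : (sphericalPart 1 ν).prod radialMeasure = ν.map (fun u => (θ u, ‖u‖)) := by
    refine Measure.prod_eq_generateFrom MeasurableSpace.generateFrom_measurableSet
      (generateFrom_Iic_Ioi.trans BorelSpace.measurable_eq.symm)
      MeasurableSpace.isPiSystem_measurableSet isPiSystem_Iic_Ioi
      (sphericalPart 1 ν).toFiniteSpanningSetsIn
      ⟨fun n => if n = 0 then Iic 0 else Ioi (n : ℝ)⁻¹, ?_, ?_, ?_⟩ ?_
    · intro n
      split_ifs with h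
      · exact Or.inl ⟨0, le_rfl, rfl⟩
      · exact Or.inr ⟨(n : ℝ)⁻¹, by positivity, rfl⟩
    · intro n
      split_ifs with h
      · rw [radialMeasure_Iic le_rfl]; simp
      · rw [radialMeasure_Ioi (by positivity)]; simp
    · refine eq_univ_of_forall fun x => mem_iUnion.2 ?_
      rcases le_or_gt x 0 with hx | hx
      · exact ⟨0, by simpa using hx⟩
      · obtain ⟨n, hn⟩ := exists_nat_one_div_lt hx
        refine ⟨n + 1, ?_⟩
        simpa using hn
    · rintro B hB _ (⟨a, ha, rfl⟩ | ⟨a, ha, rfl⟩)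
      · rw [radialMeasure_Iic ha, mul_zero,
          Measure.map_apply hq (MeasurableSet.prod hB measurableSet_Iic)]
        refine measure_mono_null ?_ hν.zero_singleton
        rintro u ⟨-, hu⟩
        have : ‖u‖ ≤ a := hu
        simpa using this.trans ha
      · have hemb : MeasurableEmbedding
            (Subtype.val : Metric.sphere (0 : EuclideanSpace ℝ (Fin d)) 1 → _) :=
          MeasurableEmbedding.subtype_coe Metric.isClosed_sphere.measurableSet
        rw [radialMeasure_Ioi ha, sphericalPart_apply hB, mul_comm,
          ← measure_cone_eq hscale (hemb.measurableSet_image.2 hB) ha,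
          Measure.map_apply hq (MeasurableSet.prod hB measurableSet_Ioi)]
        congr 1
        ext u
        simp only [mem_preimage, mem_prod, mem_Ioi, mem_ofPred_eq]
        rw [and_comm, and_congr_right_iff]
        intro hu
        rw [← hθu u (ha.trans hu), Subtype.val_injective.mem_set_image]
  change ν = ((sphericalPart 1 ν).prod radialMeasure).map _
  rw [key, Measure.map_map (by fun_prop) hq]
  conv_lhs => rw [← Measure.map_id (μ := ν)]
  congr 1
  ext1 u
  rcases eq_or_ne u 0 with rfl | hu
  · simp
  · have := norm_pos_iff.2 hu
    simp [hθu u this, smul_smul, this.ne']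

theorem sFinite_polarMeasure (α : ℝ) (σ : Measure (Metric.sphere (0 : EuclideanSpace ℝ (Fin d)) 1))
    [IsFiniteMeasure σ] : SFinite (polarMeasure α σ) := by
  unfold polarMeasure; infer_instance

/-- The integral factors into a radial integral times `∫ x σ(dx)`. The product formula needs no
integrability, so `k` is arbitrary. -/
theorem integral_norm_smul_polarMeasure
    (σ : Measure (Metric.sphere (0 : EuclideanSpace ℝ (Fin d)) 1)) [IsFiniteMeasure σ]
    (hσ : ∫ x, (x : EuclideanSpace ℝ (Fin d)) ∂σ = 0) {k : ℝ → ℝ} (hk : Measurable k) :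
    ∫ v, k ‖v‖ • v ∂(polarMeasure 1 σ) = 0 := by
  change ∫ v, k ‖v‖ • v ∂((σ.prod radialMeasure).map _) = 0
  rw [integral_map (by fun_prop) (by fun_prop)]
  have : ∀ p : Metric.sphere (0 : EuclideanSpace ℝ (Fin d)) 1 × ℝ,
      k ‖p.2 • (p.1 : EuclideanSpace ℝ (Fin d))‖ • p.2 • (p.1 : EuclideanSpace ℝ (Fin d))
        = (k |p.2| * p.2) • (p.1 : EuclideanSpace ℝ (Fin d)) := by
    intro p
    simp [norm_smul, smul_smul]
  simp_rw [this]
  rw [← integral_prod_swap]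
  simp only [Prod.fst_swap, Prod.snd_swap]
  rw [integral_prod_smul (fun r => k |r| * r)
    (fun x : Metric.sphere (0 : EuclideanSpace ℝ (Fin d)) 1 => (x : EuclideanSpace ℝ (Fin d))),
    hσ, smul_zero]

end Polar

/-! ### The Lévy generator on bounded functions with Lipschitz derivative, and its scaling. -/

section Generator

open Filter Topology

variable {E G G' : Type*} [NormedAddCommGroup E] [InnerProductSpace ℝ E]
  [NormedAddCommGroup G] [NormedSpace ℝ G] [NormedAddCommGroup G'] [NormedSpace ℝ G']

/-- `F` is differentiable, `F` and its derivative are bounded by `K`, and the derivative is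
`K`-Lipschitz. -/
structure IsBoundedC11 (F : E → G) (K : ℝ) : Prop where
  differentiable : Differentiable ℝ F
  norm_le : ∀ x, ‖F x‖ ≤ K
  norm_fderiv_le : ∀ x, ‖fderiv ℝ F x‖ ≤ K
  norm_fderiv_sub_le : ∀ x y, ‖fderiv ℝ F x - fderiv ℝ F y‖ ≤ K * ‖x - y‖

namespace IsBoundedC11

variable {F : E → G} {K : ℝ}

theorem nonneg (h : IsBoundedC11 F K) : 0 ≤ K := (norm_nonneg _).trans (h.norm_le 0)

theorem mono (h : IsBoundedC11 F K) {L : ℝ} (hL : K ≤ L) : IsBoundedC11 F L where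
  differentiable := h.differentiable
  norm_le x := (h.norm_le x).trans hL
  norm_fderiv_le x := (h.norm_fderiv_le x).trans hL
  norm_fderiv_sub_le x y := (h.norm_fderiv_sub_le x y).trans (by gcongr)

theorem continuous_fderiv (h : IsBoundedC11 F K) : Continuous (fderiv ℝ F) := by
  refine (LipschitzWith.of_dist_le_mul (K := K.toNNReal) fun x y => ?_).continuous
  rw [dist_eq_norm, dist_eq_norm, Real.coe_toNNReal _ h.nonneg]
  exact h.norm_fderiv_sub_le x y

theorem norm_taylor_le (h : IsBoundedC11 F K) (x u : E) :
    ‖F (x + u) - F x - fderiv ℝ F x u‖ ≤ K * ‖u‖ ^ 2 := by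
  have := (convex_closedBall x ‖u‖).norm_image_sub_le_of_norm_fderiv_le' (𝕜 := ℝ) (f := F)
    (φ := fderiv ℝ F x) (C := K * ‖u‖) (x := x) (y := x + u)
    (fun y _ => h.differentiable y) (fun y hy => ?_) (by simp) (by simp)
  · simpa [pow_two, mul_assoc] using this
  · refine (h.norm_fderiv_sub_le y x).trans ?_
    have hy' : ‖y - x‖ ≤ ‖u‖ := by simpa [dist_eq_norm] using hy
    have := h.nonneg
    gcongr

/-- The same `K` serves for all `|t| ≤ 1`, so dilated cutoffs satisfy uniform bounds. -/
theorem comp_smul (h : IsBoundedC11 F K) {t : ℝ} (ht : |t| ≤ 1) :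
    IsBoundedC11 (fun x => F (t • x)) K := by
  have hd (x) : fderiv ℝ (fun x => F (t • x)) x = t • fderiv ℝ F (t • x) := fderiv_comp_smul t
  have hK := h.nonneg
  refine ⟨fun x => (h.differentiable _).comp x (by fun_prop), fun x => h.norm_le _, fun x => ?_,
    fun x y => ?_⟩
  · rw [hd, norm_smul]
    exact (mul_le_of_le_one_left (norm_nonneg _) ht).trans (h.norm_fderiv_le _)
  · rw [hd, hd, ← smul_sub, norm_smul]
    refine (mul_le_of_le_one_left (norm_nonneg _) ht).trans
      ((h.norm_fderiv_sub_le _ _).trans ?_)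
    rw [← smul_sub, norm_smul]
    gcongr
    exact mul_le_of_le_one_left (norm_nonneg _) ht

theorem mul {F H : E → ℂ} {L : ℝ} (hF : IsBoundedC11 F K) (hH : IsBoundedC11 H L) :
    IsBoundedC11 (fun x => F x * H x) (4 * (K * L)) := by
  have hd (x) : fderiv ℝ (fun x => F x * H x) x = F x • fderiv ℝ H x + H x • fderiv ℝ F x :=
    fderiv_fun_mul (hF.differentiable x) (hH.differentiable x)
  have hK := hF.nonneg
  have hL := hH.nonneg
  have lip {F : E → ℂ} {K : ℝ} (hF : IsBoundedC11 F K) (x y) : ‖F x - F y‖ ≤ K * ‖x - y‖ :=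
    convex_univ.norm_image_sub_le_of_norm_fderiv_le (𝕜 := ℝ) (fun z _ => hF.differentiable z)
      (fun z _ => hF.norm_fderiv_le z) (mem_univ y) (mem_univ x)
  have prod {F H : E → ℂ} {K L : ℝ} (hF : IsBoundedC11 F K) (hH : IsBoundedC11 H L) (x y) :
      ‖F x • fderiv ℝ H x - F y • fderiv ℝ H y‖ ≤ 2 * (K * L) * ‖x - y‖ := by
    have hK := hF.nonneg
    have hL := hH.nonneg
    have : F x • fderiv ℝ H x - F y • fderiv ℝ H y
        = F x • (fderiv ℝ H x - fderiv ℝ H y) + (F x - F y) • fderiv ℝ H y := by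
      ext v
      simp only [add_apply, sub_apply, smul_apply, smul_eq_mul]
      ring
    rw [this]
    refine (norm_add_le _ _).trans ?_
    rw [norm_smul, norm_smul]
    calc _ ≤ K * (L * ‖x - y‖) + (K * ‖x - y‖) * L := by
          gcongr
          · exact hF.norm_le x
          · exact hH.norm_fderiv_sub_le x y
          · exact lip hF x y
          · exact hH.norm_fderiv_le y
      _ = _ := by ring
  refine ⟨hF.differentiable.mul hH.differentiable, fun x => ?_, fun x => ?_, fun x y => ?_⟩
  · rw [norm_mul]
    have : ‖F x‖ * ‖H x‖ ≤ K * L := by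
      gcongr
      · exact hF.norm_le x
      · exact hH.norm_le x
    nlinarith [mul_nonneg hK hL]
  · rw [hd]
    refine (norm_add_le _ _).trans ?_
    rw [norm_smul, norm_smul]
    have : ‖F x‖ * ‖fderiv ℝ H x‖ + ‖H x‖ * ‖fderiv ℝ F x‖ ≤ K * L + L * K := by
      gcongr
      · exact hF.norm_le x
      · exact hH.norm_fderiv_le x
      · exact hH.norm_le x
      · exact hF.norm_fderiv_le x
    nlinarith [mul_nonneg hK hL]
  · rw [hd, hd, add_sub_add_comm]
    refine (norm_add_le _ _).trans ?_
    linarith [prod hF hH x y, prod hH hF x y]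

end IsBoundedC11

/-- The compensated increment `F (x + u) - F x - DF(x) u 1_{‖u‖ ≤ 1}`. -/
noncomputable def compensatedIncrement (F : E → G) (x u : E) : G :=
  F (x + u) - F x - (Metric.closedBall (0 : E) 1).indicator (fderiv ℝ F x) u

/-- Taylor's bound for small jumps and the sup bound for large ones. This is the majorant for every
integral against `ν`. -/
theorem IsBoundedC11.norm_compensatedIncrement_le {F : E → G} {K : ℝ} (h : IsBoundedC11 F K)
    (x u : E) : ‖compensatedIncrement F x u‖ ≤ 2 * K * min 1 (‖u‖ ^ 2) := by
  have hK := h.nonneg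
  rw [compensatedIncrement]
  rcases le_or_gt ‖u‖ 1 with hu | hu
  · rw [indicator_of_mem (by simpa using hu), min_eq_right (pow_le_one₀ (norm_nonneg _) hu)]
    refine (h.norm_taylor_le x u).trans ?_
    nlinarith [mul_nonneg hK (sq_nonneg ‖u‖)]
  · rw [indicator_of_notMem (by simpa using hu), sub_zero, min_eq_left (one_le_pow₀ hu.le)]
    refine (norm_sub_le _ _).trans ?_
    linarith [h.norm_le (x + u), h.norm_le x]

variable [MeasurableSpace E]

/-- The generator with drift `b` and jump measure `ν`. -/
noncomputable def levyGenerator (ν : Measure E) (b : E) (F : E → G) (x : E) : G :=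
  fderiv ℝ F x b + ∫ u, compensatedIncrement F x u ∂ν

variable {F : E → G} {K : ℝ} {ν : Measure E}

theorem IsBoundedC11.norm_levyGenerator_le (h : IsBoundedC11 F K)
    (hν : Integrable (fun u => min 1 (‖u‖ ^ 2)) ν) (b x : E) :
    ‖levyGenerator ν b F x‖ ≤ K * ‖b‖ + 2 * K * ∫ u, min 1 (‖u‖ ^ 2) ∂ν := by
  refine (norm_add_le _ _).trans (add_le_add ?_ ?_)
  · exact ((fderiv ℝ F x).le_opNorm b).trans (by gcongr; exact h.norm_fderiv_le x)
  · rw [← integral_const_mul]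
    exact norm_integral_le_of_norm_le (hν.const_mul _)
      (Eventually.of_forall (h.norm_compensatedIncrement_le x))

variable [FiniteDimensional ℝ E] [BorelSpace E]

theorem IsBoundedC11.stronglyMeasurable_compensatedIncrement (h : IsBoundedC11 F K) (x : E) :
    StronglyMeasurable (compensatedIncrement F x) := by
  have := h.differentiable.continuous
  refine StronglyMeasurable.sub (Continuous.stronglyMeasurable (by fun_prop))
    ((ContinuousLinearMap.continuous _).stronglyMeasurable.indicator
      Metric.isClosed_closedBall.measurableSet)

theorem IsBoundedC11.integrable_compensatedIncrement (h : IsBoundedC11 F K)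
    (hν : Integrable (fun u => min 1 (‖u‖ ^ 2)) ν) (x : E) :
    Integrable (compensatedIncrement F x) ν :=
  (hν.const_mul (2 * K)).mono' (h.stronglyMeasurable_compensatedIncrement x).aestronglyMeasurable
    (Eventually.of_forall (h.norm_compensatedIncrement_le x))

/-- Function and base point both vary, so that one dominated convergence covers continuity in `x`,
removal of cutoffs and continuity of the symbol in `ξ`. -/
theorem tendsto_levyGenerator {ι : Type*} {l : Filter ι} [l.IsCountablyGenerated]
    (hν : Integrable (fun u => min 1 (‖u‖ ^ 2)) ν) (b : E) {Φ : ι → E → G} {y : ι → E}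
    (hΦ : ∀ᶠ n in l, IsBoundedC11 (Φ n) K) {x : E}
    (h0 : ∀ u, Tendsto (fun n => Φ n (y n + u)) l (𝓝 (F (x + u))))
    (h1 : Tendsto (fun n => fderiv ℝ (Φ n) (y n)) l (𝓝 (fderiv ℝ F x))) :
    Tendsto (fun n => levyGenerator ν b (Φ n) (y n)) l (𝓝 (levyGenerator ν b F x)) := by
  have h1' (u : E) : Tendsto (fun n => fderiv ℝ (Φ n) (y n) u) l (𝓝 (fderiv ℝ F x u)) :=
    ((ContinuousLinearMap.apply ℝ G u).continuous.tendsto _).comp h1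
  refine (h1' b).add (tendsto_integral_filter_of_dominated_convergence _ ?_ ?_
    (hν.const_mul (2 * K)) ?_)
  · filter_upwards [hΦ] with n hn
      using (hn.stronglyMeasurable_compensatedIncrement _).aestronglyMeasurable
  · filter_upwards [hΦ] with n hn
      using Eventually.of_forall (hn.norm_compensatedIncrement_le _)
  · refine Eventually.of_forall fun u => ?_
    refine Tendsto.sub (Tendsto.sub (h0 u) (by simpa using h0 0)) ?_
    by_cases hu : u ∈ Metric.closedBall (0 : E) 1
    · simpa only [indicator_of_mem hu] using h1' u
    · simpa only [indicator_of_notMem hu] using tendsto_const_nhds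

theorem IsBoundedC11.continuous_levyGenerator (h : IsBoundedC11 F K)
    (hν : Integrable (fun u => min 1 (‖u‖ ^ 2)) ν) (b : E) :
    Continuous (levyGenerator ν b F) := by
  refine continuous_iff_continuousAt.2 fun x => ?_
  refine tendsto_levyGenerator (K := K) (Φ := fun _ => F) (y := id) hν b
    (Eventually.of_forall fun _ => h) (fun u => ?_) ?_
  · exact (h.differentiable.continuous.comp (continuous_id.add continuous_const)).tendsto x
  · exact h.continuous_fderiv.tendsto x

theorem IsBoundedC11.levyGenerator_comp_clm [CompleteSpace G] [CompleteSpace G']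
    (h : IsBoundedC11 F K) (hν : Integrable (fun u => min 1 (‖u‖ ^ 2)) ν) (b : E)
    (L : G →L[ℝ] G') (x : E) :
    levyGenerator ν b (fun y => L (F y)) x = L (levyGenerator ν b F x) := by
  have hd : fderiv ℝ (fun x => L (F x)) x = L.comp (fderiv ℝ F x) :=
    (L.hasFDerivAt.comp x (h.differentiable x).hasFDerivAt).fderiv
  rw [levyGenerator, levyGenerator, map_add, hd,
    ← L.integral_comp_comm (h.integrable_compensatedIncrement hν x)]
  congr 2
  ext u
  by_cases hu : u ∈ Metric.closedBall (0 : E) 1 <;> simp [compensatedIncrement, hd, hu]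

/-- A generator with `ν(B) = c⁻¹ ν(B / c)` and centred spherical part commutes with dilations up
to the factor of the dilation. -/
theorem IsBoundedC11.levyGenerator_comp_smul [CompleteSpace G] (h : IsBoundedC11 F K)
    (hν : Integrable (fun u => min 1 (‖u‖ ^ 2)) ν)
    (hscale : ∀ c : ℝ, 0 < c → ν = ENNReal.ofReal c⁻¹ • ν.map (fun u => c • u))
    (hzero : ∀ k : ℝ → ℝ, Measurable k → ∫ v, k ‖v‖ • v ∂ν = 0)
    (b : E) {t : ℝ} (ht : 0 < t) (x : E) :
    levyGenerator ν b (fun y => F (t • y)) x = t • levyGenerator ν b F (t • x) := by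
  have hd : fderiv ℝ (fun x => F (t • x)) x = t • fderiv ℝ F (t • x) := fderiv_comp_smul t
  have hmap : ν.map (fun u => t • u) = ENNReal.ofReal t • ν := by
    conv_rhs => rw [hscale t ht]
    rw [smul_smul, ← ENNReal.ofReal_mul ht.le, mul_inv_cancel₀ ht.ne', ENNReal.ofReal_one,
      one_smul]
  let ℓ := fderiv ℝ F (t • x)
  -- Putting `v = t u` turns the truncation `‖u‖ ≤ 1` into `‖v‖ ≤ t`; `k` is the discrepancy from
  -- `‖v‖ ≤ 1`.
  let k : ℝ → ℝ := fun r => (Iic 1).indicator 1 r - (Iic t).indicator 1 r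
  have hk : Measurable k :=
    ((measurable_one.indicator measurableSet_Iic).sub (measurable_one.indicator measurableSet_Iic))
  have hkv : Integrable (fun v : E => k ‖v‖ • v) ν := by
    -- `k` lives between the radii `1` and `t`: there `‖v‖ ≤ 1 ≤ t⁻² ‖v‖²` if `t < ‖v‖ ≤ 1`, and
    -- `‖v‖ ≤ t` if `1 < ‖v‖ ≤ t`.
    refine (hν.const_mul (max t 1 * max 1 (t⁻¹ ^ 2))).mono' ?_ (Eventually.of_forall fun v => ?_)
    · exact ((hk.comp measurable_norm).smul measurable_id).aestronglyMeasurable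
    · have hmin : (0 : ℝ) ≤ min 1 (‖v‖ ^ 2) := by positivity
      have hmax : (1 : ℝ) ≤ max 1 (t⁻¹ ^ 2) := le_max_left _ _
      rw [norm_smul]
      by_cases h1 : ‖v‖ ≤ 1 <;> by_cases h2 : ‖v‖ ≤ t
      · simp only [k, indicator, mem_Iic, h1, h2, if_true, Pi.one_apply, sub_self, norm_zero,
          zero_mul]
        positivity
      · have h2' := not_le.1 h2
        simp only [k, indicator, mem_Iic, h1, h2, if_true, if_false, Pi.one_apply, sub_zero,
          norm_one, one_mul]
        rw [min_eq_right (pow_le_one₀ (norm_nonneg _) h1), mul_assoc]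
        have : 1 ≤ max 1 (t⁻¹ ^ 2) * ‖v‖ ^ 2 := by
          calc 1 = t⁻¹ ^ 2 * t ^ 2 := by field_simp
            _ ≤ _ := by
              gcongr
              exact le_max_right _ _
        calc ‖v‖ ≤ 1 * 1 := by simpa using h1
          _ ≤ _ := by
            gcongr
            exact le_max_right _ _
      · have h1' := not_le.1 h1
        simp only [k, indicator, mem_Iic, h1, h2, if_true, if_false, Pi.one_apply, zero_sub,
          norm_neg, norm_one, one_mul]
        rw [min_eq_left (one_le_pow₀ h1'.le), mul_one]
        calc ‖v‖ ≤ t * 1 := by simpa using h2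
          _ ≤ _ := by
            gcongr
            exact le_max_left _ _
      · simp only [k, indicator, mem_Iic, h1, h2, if_false, sub_self, norm_zero, zero_mul]
        positivity
  have hkl : Integrable (fun v : E => k ‖v‖ • ℓ v) ν := by
    simpa using ℓ.integrable_comp hkv
  have hkz : ∫ v, k ‖v‖ • ℓ v ∂ν = 0 := by
    have := ℓ.integral_comp_comm hkv
    simpa [hzero k hk] using this
  have e1 (u : E) : compensatedIncrement (fun y => F (t • y)) x u
      = compensatedIncrement F (t • x) (t • u) + k ‖t • u‖ • ℓ (t • u) := by
    have hi (u : E) (r : ℝ) (ℓ : E →L[ℝ] G) : (Metric.closedBall (0 : E) r).indicator ℓ u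
        = ((Iic r).indicator 1 ‖u‖ : ℝ) • ℓ u := by
      by_cases hu : ‖u‖ ≤ r <;> simp [indicator, hu]
    have ht' : (Iic t).indicator (1 : ℝ → ℝ) ‖t • u‖ = (Iic 1).indicator 1 ‖u‖ := by
      simp [indicator, norm_smul, abs_of_pos ht, mul_le_iff_le_one_right ht]
    rw [compensatedIncrement, compensatedIncrement, hd, hi, hi, smul_add]
    simp only [k, sub_smul, ht', ℓ, smul_apply, map_smul]
    abel
  have hint := h.integrable_compensatedIncrement hν (t • x)
  have hm : StronglyMeasurable (fun v => compensatedIncrement F (t • x) v + k ‖v‖ • ℓ v) :=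
    (h.stronglyMeasurable_compensatedIncrement _).add
      ((hk.comp measurable_norm).stronglyMeasurable.smul ℓ.continuous.stronglyMeasurable)
  have e2 : ∫ u, compensatedIncrement (fun y => F (t • y)) x u ∂ν
      = t • ∫ u, compensatedIncrement F (t • x) u ∂ν := by
    simp_rw [e1]
    rw [← integral_map (φ := fun u : E => t • u)
      (f := fun v => compensatedIncrement F (t • x) v + k ‖v‖ • ℓ v) (by fun_prop)
      hm.aestronglyMeasurable, hmap, integral_smul_measure, integral_add hint hkl, hkz, add_zero,
      ENNReal.toReal_ofReal ht.le]
  rw [levyGenerator, levyGenerator, e2, hd, smul_add]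
  rfl

end Generator

/-! ### The Stein equation in integrated form. -/

section Stein

open Filter Topology
open scoped ContDiff

variable {E G G' : Type*} [NormedAddCommGroup E] [InnerProductSpace ℝ E]
  [NormedAddCommGroup G] [NormedSpace ℝ G] [NormedAddCommGroup G'] [NormedSpace ℝ G']

theorem SchwartzMap.exists_isBoundedC11 (g : 𝓢(E, G)) : ∃ K, IsBoundedC11 g K := by
  let g' := fderivCLM ℝ E G g
  let g'' := fderivCLM ℝ E (E →L[ℝ] G) g'
  let K₀ := SchwartzMap.seminorm ℝ 0 0 g
  let K₁ := SchwartzMap.seminorm ℝ 0 0 g'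
  let K₂ := SchwartzMap.seminorm ℝ 0 0 g''
  refine ⟨max K₀ (max K₁ K₂), g.differentiable, fun x => ?_, fun x => ?_, fun x y => ?_⟩
  · exact (norm_le_seminorm ℝ g x).trans (le_max_left _ _)
  · exact (norm_le_seminorm ℝ g' x).trans ((le_max_left _ _).trans (le_max_right _ _))
  · refine (convex_univ.norm_image_sub_le_of_norm_fderiv_le (𝕜 := ℝ) (f := g')
      (fun z _ => g'.differentiable z) (fun z _ => norm_le_seminorm ℝ g'' z)
      (mem_univ y) (mem_univ x)).trans ?_
    gcongr
    exact (le_max_right _ _).trans (le_max_right _ _)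

/-- Makes `⟨x, ∇g(x)⟩` bounded, hence integrable for every law, with no moment of `X` required. -/
theorem SchwartzMap.exists_norm_mul_norm_fderiv_le (g : 𝓢(E, G)) :
    ∃ C, 0 ≤ C ∧ ∀ x, ‖x‖ * ‖fderiv ℝ g x‖ ≤ C := by
  refine ⟨SchwartzMap.seminorm ℝ 1 0 (fderivCLM ℝ E G g), apply_nonneg _ _, fun x => ?_⟩
  simpa using norm_pow_mul_le_seminorm ℝ (fderivCLM ℝ E G g) 1 x

theorem SchwartzMap.continuous_fderiv_apply (g : 𝓢(E, G)) (t : ℝ) :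
    Continuous fun x => fderiv ℝ g (t • x) x := by
  have := (fderivCLM ℝ E G g).continuous
  have h : Continuous (fderiv ℝ g) := this
  exact (h.comp (continuous_const_smul t)).clm_apply continuous_id

variable [MeasurableSpace E] [FiniteDimensional ℝ E] [BorelSpace E]
  {μ : Measure E} [IsProbabilityMeasure μ] {ν : Measure E} {b : E}

theorem SchwartzMap.integrable_fderiv_apply (g : 𝓢(E, G)) :
    Integrable (fun x => fderiv ℝ g x x) μ := by
  obtain ⟨C, -, hC⟩ := g.exists_norm_mul_norm_fderiv_le
  have := g.continuous_fderiv_apply 1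
  simp only [one_smul] at this
  refine Integrable.of_bound this.aestronglyMeasurable C (Eventually.of_forall fun x => ?_)
  exact ((fderiv ℝ g x).le_opNorm x).trans ((mul_comm _ _).trans_le (hC x))

theorem IsBoundedC11.integrable_levyGenerator {F : E → G} {K : ℝ} (h : IsBoundedC11 F K)
    (hν : Integrable (fun u => min 1 (‖u‖ ^ 2)) ν) (b : E) :
    Integrable (levyGenerator ν b F) μ :=
  Integrable.of_bound (h.continuous_levyGenerator hν b).aestronglyMeasurable _
    (Eventually.of_forall (h.norm_levyGenerator_le hν b))

/-- The Stein equation for real Schwartz functions and for complex ones are equivalent. -/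
theorem stein_real_iff_complex (hν : Integrable (fun u => min 1 (‖u‖ ^ 2)) ν) :
    (∀ f : 𝓢(E, ℝ), ∫ x, fderiv ℝ f x x ∂μ = ∫ x, levyGenerator ν b f x ∂μ) ↔
      ∀ g : 𝓢(E, ℂ), ∫ x, fderiv ℝ g x x ∂μ = ∫ x, levyGenerator ν b g x ∂μ := by
  have key {G G' : Type} [NormedAddCommGroup G] [NormedSpace ℝ G] [NormedAddCommGroup G']
      [NormedSpace ℝ G'] [CompleteSpace G] [CompleteSpace G'] (L : G →L[ℝ] G') (g : 𝓢(E, G)) :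
      ∫ x, fderiv ℝ (g.postcompCLM L) x x ∂μ = L (∫ x, fderiv ℝ g x x ∂μ) ∧
      ∫ x, levyGenerator ν b (g.postcompCLM L) x ∂μ = L (∫ x, levyGenerator ν b g x ∂μ) := by
    obtain ⟨K, hK⟩ := g.exists_isBoundedC11
    have hcoe : ⇑(g.postcompCLM L) = fun x => L (g x) := rfl
    rw [hcoe]
    constructor
    · rw [← L.integral_comp_comm g.integrable_fderiv_apply]
      congr 1
      ext x
      have hd : fderiv ℝ (fun x => L (g x)) x = L.comp (fderiv ℝ g x) :=
        (L.hasFDerivAt.comp x (g.differentiable x).hasFDerivAt).fderiv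
      rw [hd]
      rfl
    · rw [← L.integral_comp_comm (hK.integrable_levyGenerator hν b)]
      congr 1
      ext x
      exact hK.levyGenerator_comp_clm hν b L x
  constructor
  · intro h g
    apply Complex.ext
    · have := h (g.postcompCLM Complex.reCLM)
      rwa [(key Complex.reCLM g).1, (key Complex.reCLM g).2] at this
    · have := h (g.postcompCLM Complex.imCLM)
      rwa [(key Complex.imCLM g).1, (key Complex.imCLM g).2] at this
  · intro h f
    have := h (f.postcompCLM Complex.ofRealCLM)
    rw [(key Complex.ofRealCLM f).1, (key Complex.ofRealCLM f).2] at this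
    exact Complex.ofReal_injective this

theorem continuous_integral_comp_smul {H : E → G} (hH : Continuous H) {C : ℝ}
    (hC : ∀ x, ‖H x‖ ≤ C) : Continuous fun t : ℝ => ∫ x, H (t • x) ∂μ :=
  continuous_of_dominated (bound := fun _ => C)
    (fun t => (hH.comp (continuous_const_smul t)).aestronglyMeasurable)
    (fun _ => Eventually.of_forall fun _ => hC _) (integrable_const C)
    (Eventually.of_forall fun _ => hH.comp (continuous_id.smul continuous_const))

theorem SchwartzMap.hasDerivAt_integral_comp_smul (g : 𝓢(E, G)) {t : ℝ} (ht : 0 < t) :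
    HasDerivAt (fun t : ℝ => ∫ x, g (t • x) ∂μ) (∫ x, fderiv ℝ g (t • x) x ∂μ) t := by
  obtain ⟨C, hC0, hC⟩ := g.exists_norm_mul_norm_fderiv_le
  obtain ⟨K, hK⟩ := g.exists_isBoundedC11
  refine (hasDerivAt_integral_of_dominated_loc_of_deriv_le (bound := fun _ => C / (t / 2))
    (F' := fun s x => fderiv ℝ g (s • x) x)
    -- For `s > t / 2`, the decay of `∇g` gives `‖x‖ ‖∇g(s x)‖ ≤ C / s ≤ C / (t / 2)`.
    (Ioi_mem_nhds (show t / 2 < t by linarith)) (Eventually.of_forall fun s => ?_) ?_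
    (g.continuous_fderiv_apply t).aestronglyMeasurable
    (Eventually.of_forall fun x s hs => ?_) (integrable_const _)
    (Eventually.of_forall fun x s hs => ?_)).2
  · exact (g.continuous.comp (continuous_const_smul s)).aestronglyMeasurable
  · exact Integrable.of_bound (g.continuous.comp (continuous_const_smul t)).aestronglyMeasurable K
      (Eventually.of_forall fun x => hK.norm_le _)
  · have hs' : t / 2 < s := hs
    have hs0 : 0 < s := by linarith
    rw [le_div_iff₀ (by linarith)]
    calc ‖fderiv ℝ g (s • x) x‖ * (t / 2) ≤ (‖fderiv ℝ g (s • x)‖ * ‖x‖) * s := by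
          gcongr
          exact ContinuousLinearMap.le_opNorm _ _
      _ = ‖s • x‖ * ‖fderiv ℝ g (s • x)‖ := by
          rw [norm_smul, Real.norm_of_nonneg hs0.le]; ring
      _ ≤ C := hC _
  · have h1 : HasDerivAt (fun s : ℝ => s • x) x s := by
      simpa using (hasDerivAt_id s).smul_const x
    exact (g.hasFDerivAt (s • x)).comp_hasDerivAt s h1

/-- The measure has the scaling and centring properties of the Lévy measure of a strictly
`1`-stable law. -/
structure IsScalingCentred (ν : Measure E) : Prop where
  integrable : Integrable (fun u => min 1 (‖u‖ ^ 2)) ν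
  eq_smul_map : ∀ c : ℝ, 0 < c → ν = ENNReal.ofReal c⁻¹ • ν.map (fun u => c • u)
  integral_eq_zero : ∀ k : ℝ → ℝ, Measurable k → ∫ v, k ‖v‖ • v ∂ν = 0

theorem integral_sub_eq_of_stein (hν : IsScalingCentred ν)
    (h : ∀ g : 𝓢(E, ℂ), ∫ x, fderiv ℝ g x x ∂μ = ∫ x, levyGenerator ν b g x ∂μ)
    (g : 𝓢(E, ℂ)) {t : ℝ} (ht : 0 ≤ t) :
    ∫ x, g (t • x) ∂μ - g 0 = ∫ r in 0..t, ∫ x, levyGenerator ν b g (r • x) ∂μ := by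
  obtain ⟨K, hK⟩ := g.exists_isBoundedC11
  have hd : ∀ r ∈ Ioo 0 t, HasDerivAt (fun r : ℝ => ∫ x, g (r • x) ∂μ)
      (∫ x, levyGenerator ν b g (r • x) ∂μ) r := by
    intro r hr
    have hr0 := hr.1
    suffices e : ∫ x, levyGenerator ν b g (r • x) ∂μ = ∫ x, fderiv ℝ g (r • x) x ∂μ by
      rw [e]
      exact g.hasDerivAt_integral_comp_smul hr0
    -- The Stein equation for `g(r·)` carries a factor `r` on both sides, which cancels.
    let A : E ≃L[ℝ] E := ContinuousLinearEquiv.smulLeft (Units.mk0 r hr0.ne')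
    have hA := h (SchwartzMap.compCLMOfContinuousLinearEquiv ℝ A g)
    have hcoe : ⇑(SchwartzMap.compCLMOfContinuousLinearEquiv ℝ A g) = fun x => g (r • x) := rfl
    have hf (x) : fderiv ℝ (fun x => g (r • x)) x = r • fderiv ℝ g (r • x) := fderiv_comp_smul r
    simp_rw [hcoe, hf, hK.levyGenerator_comp_smul hν.integrable hν.eq_smul_map
      hν.integral_eq_zero b hr0, smul_apply, integral_smul] at hA
    exact (smul_right_injective ℂ hr0.ne' hA).symm
  -- The derivative is only needed on the open interval; at `r = 0` continuity suffices.
  rw [intervalIntegral.integral_eq_sub_of_hasDerivAt_of_le ht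
    (continuous_integral_comp_smul g.continuous hK.norm_le).continuousOn hd
    ((continuous_integral_comp_smul (hK.continuous_levyGenerator hν.integrable b)
      (hK.norm_levyGenerator_le hν.integrable b)).intervalIntegrable _ _)]
  simp

/-- Both sides involve only bounded quantities, so the identity passes to the limit along `F χ(ε
x)`, `ε → 0`. The Stein equation itself would not: `⟨x, ∇F(x)⟩` can be unbounded. -/
theorem IsBoundedC11.integral_sub_eq_of_stein {F : E → ℂ} {K : ℝ} (hF : IsBoundedC11 F K)
    (hFs : ContDiff ℝ ∞ F) (hν : IsScalingCentred ν)
    (h : ∀ g : 𝓢(E, ℂ), ∫ x, fderiv ℝ g x x ∂μ = ∫ x, levyGenerator ν b g x ∂μ)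
    {t : ℝ} (ht : 0 ≤ t) :
    ∫ x, F (t • x) ∂μ - F 0 = ∫ r in 0..t, ∫ x, levyGenerator ν b F (r • x) ∂μ := by
  let β : ContDiffBump (0 : E) := default
  let χ : E → ℂ := fun x => (β x : ℂ)
  have hχs : ContDiff ℝ ∞ χ := Complex.ofRealCLM.contDiff.comp β.contDiff
  have hχc : HasCompactSupport χ := β.hasCompactSupport.comp_left Complex.ofReal_zero
  obtain ⟨L, hL⟩ := (hχc.toSchwartzMap hχs).exists_isBoundedC11
  change IsBoundedC11 χ L at hL
  let ε : ℕ → ℝ := fun n => 1 / ((n : ℝ) + 1)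
  have hε0 (n) : 0 < ε n := by positivity
  have hε1 (n) : |ε n| ≤ 1 := by
    rw [abs_of_pos (hε0 n)]
    exact div_le_one_of_le₀ (by simp) (by positivity)
  have hε : Tendsto ε atTop (𝓝 0) := tendsto_one_div_add_atTop_nhds_zero_nat
  let Φ : ℕ → E → ℂ := fun n x => F x * χ (ε n • x)
  have hΦc (n) : HasCompactSupport (Φ n) :=
    HasCompactSupport.mul_left (hχc.comp_smul (hε0 n).ne')
  have hΦs (n) : ContDiff ℝ ∞ (Φ n) := hFs.mul (hχs.comp (contDiff_const_smul _))
  set M := 4 * (K * L)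
  have hΦ (n) : IsBoundedC11 (Φ n) M := hF.mul (hL.comp_smul (hε1 n))
  -- The cutoff is eventually `1` near each point, so values and derivatives there are eventually
  -- those of `F`.
  have hev (x : E) : ∀ᶠ n in atTop, Φ n =ᶠ[𝓝 x] F := by
    have h1 : Tendsto (fun n => ‖ε n • x‖) atTop (𝓝 0) := by
      simpa using (hε.smul_const x).norm
    filter_upwards [h1.eventually_lt_const β.rIn_pos] with n hn
    have : ∀ᶠ y in 𝓝 x, ‖ε n • y‖ < β.rIn :=
      (continuous_const_smul (ε n)).norm.tendsto x |>.eventually_lt_const hn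
    filter_upwards [this] with y hy
    have : β (ε n • y) = 1 := β.one_of_mem_closedBall (by simpa using hy.le)
    simp [Φ, χ, this]
  have h0 (x : E) : Tendsto (fun n => Φ n x) atTop (𝓝 (F x)) :=
    tendsto_const_nhds.congr' ((hev x).mono fun n hn => hn.self_of_nhds.symm)
  have hA (x : E) : Tendsto (fun n => levyGenerator ν b (Φ n) x) atTop
      (𝓝 (levyGenerator ν b F x)) :=
    tendsto_levyGenerator hν.integrable b (Eventually.of_forall hΦ) (fun u => h0 (x + u))
      (tendsto_const_nhds.congr' ((hev x).mono fun n hn => hn.fderiv_eq.symm))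
  have hcont (n) := (hΦ n).continuous_levyGenerator hν.integrable b
  have hbd (n) := (hΦ n).norm_levyGenerator_le hν.integrable b
  have hl : Tendsto (fun n => ∫ x, Φ n (t • x) ∂μ - Φ n 0) atTop
      (𝓝 (∫ x, F (t • x) ∂μ - F 0)) := by
    refine Tendsto.sub (tendsto_integral_of_dominated_convergence (fun _ => M)
      (fun n => ?_) (integrable_const M) (fun n => ?_) (Eventually.of_forall fun x => h0 _)) (h0 0)
    · exact ((hΦs n).continuous.comp (continuous_const_smul t)).aestronglyMeasurable
    · exact Eventually.of_forall fun x => (hΦ n).norm_le _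
  have hr : Tendsto (fun n => ∫ r in 0..t, ∫ x, levyGenerator ν b (Φ n) (r • x) ∂μ) atTop
      (𝓝 (∫ r in 0..t, ∫ x, levyGenerator ν b F (r • x) ∂μ)) := by
    refine intervalIntegral.tendsto_integral_filter_of_dominated_convergence
      (fun _ => M * ‖b‖ + 2 * M * ∫ u, min 1 (‖u‖ ^ 2) ∂ν)
      (Eventually.of_forall fun n => ?_) (Eventually.of_forall fun n => ?_)
      intervalIntegrable_const (Eventually.of_forall fun r _ => ?_)
    · exact (continuous_integral_comp_smul (hcont n) (hbd n)).aestronglyMeasurable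
    · refine Eventually.of_forall fun r _ => ?_
      simpa using norm_integral_le_of_norm_le_const (μ := μ)
        (Eventually.of_forall fun x => hbd n (r • x))
    · refine tendsto_integral_of_dominated_convergence _
        (fun n => ((hcont n).comp (continuous_const_smul r)).aestronglyMeasurable)
        (integrable_const _) (fun n => Eventually.of_forall fun x => hbd n _)
        (Eventually.of_forall fun x => hA _)
  refine tendsto_nhds_unique hl (hr.congr fun n => ?_)
  exact (_root_.integral_sub_eq_of_stein hν h ((hΦc n).toSchwartzMap (hΦs n)) ht).symm

end Stein

/-! ### Exponentials as eigenfunctions, and the characteristic function of a Stein solution. -/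

section Symbol

open Filter Topology
open scoped ContDiff

variable {E : Type*} [NormedAddCommGroup E] [InnerProductSpace ℝ E]

/-- The function `x ↦ e^{i⟨ξ, x⟩}`. -/
noncomputable def expInner (ξ x : E) : ℂ := Complex.exp (Complex.I * (⟪ξ, x⟫ : ℝ))

/-- The linear map `v ↦ i⟨ξ, v⟩`. -/
noncomputable def imInner (ξ : E) : E →L[ℝ] ℂ :=
  Complex.I • Complex.ofRealCLM.comp (innerSL ℝ ξ)

theorem imInner_apply (ξ v : E) : imInner ξ v = Complex.I * (⟪ξ, v⟫ : ℝ) := by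
  simp [imInner]

theorem continuous_imInner : Continuous (imInner : E → E →L[ℝ] ℂ) := by
  unfold imInner
  fun_prop

theorem norm_imInner_le (ξ : E) : ‖imInner ξ‖ ≤ ‖ξ‖ := by
  refine ContinuousLinearMap.opNorm_le_bound _ (norm_nonneg _) fun v => ?_
  rw [imInner_apply, norm_mul, Complex.norm_I, one_mul, Complex.norm_real]
  exact norm_inner_le_norm _ _

theorem expInner_add (ξ x y : E) : expInner ξ (x + y) = expInner ξ x * expInner ξ y := by
  simp [expInner, inner_add_right, mul_add, Complex.exp_add]

theorem expInner_zero (ξ : E) : expInner ξ 0 = 1 := by simp [expInner]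

theorem expInner_smul_right (ξ x : E) (t : ℝ) : expInner ξ (t • x) = expInner (t • ξ) x := by
  simp [expInner, inner_smul_left, inner_smul_right]

theorem norm_expInner (ξ x : E) : ‖expInner ξ x‖ = 1 := by
  rw [expInner, mul_comm, Complex.norm_exp_ofReal_mul_I]

theorem continuous_expInner : Continuous fun p : E × E => expInner p.1 p.2 := by
  unfold expInner
  fun_prop

theorem hasFDerivAt_expInner (ξ x : E) :
    HasFDerivAt (expInner ξ) (expInner ξ x • imInner ξ) x := by
  have h := (imInner ξ).hasFDerivAt (x := x) |>.cexp
  have e : (fun y => Complex.exp (imInner ξ y)) = expInner ξ := by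
    ext y
    rw [imInner_apply, expInner]
  rw [e, imInner_apply] at h
  exact h

theorem fderiv_expInner (ξ x : E) : fderiv ℝ (expInner ξ) x = expInner ξ x • imInner ξ :=
  (hasFDerivAt_expInner ξ x).fderiv

theorem contDiff_expInner (ξ : E) : ContDiff ℝ ∞ (expInner ξ) := by
  have h := (imInner ξ).contDiff (n := ∞) |>.cexp
  have e : (fun y => Complex.exp (imInner ξ y)) = expInner ξ := by
    ext y
    rw [imInner_apply, expInner]
  rwa [e] at h

/-- The constant dominates `1`, `‖ξ‖` and `‖ξ‖²`, and grows polynomially, so it is integrable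
against Schwartz functions of `ξ`. -/
theorem isBoundedC11_expInner (ξ : E) : IsBoundedC11 (expInner ξ) ((1 + ‖ξ‖) ^ 2) := by
  have h0 := norm_nonneg ξ
  have hn (x) : ‖fderiv ℝ (expInner ξ) x‖ ≤ ‖ξ‖ := by
    rw [fderiv_expInner, norm_smul, norm_expInner, one_mul]
    exact norm_imInner_le ξ
  have hd : Differentiable ℝ (expInner ξ) := fun x => (hasFDerivAt_expInner ξ x).differentiableAt
  refine ⟨hd, fun x => ?_, fun x => (hn x).trans (by nlinarith), fun x y => ?_⟩
  · rw [norm_expInner]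
    nlinarith
  · rw [fderiv_expInner, fderiv_expInner, ← sub_smul, norm_smul]
    have : ‖expInner ξ x - expInner ξ y‖ ≤ ‖ξ‖ * ‖x - y‖ :=
      convex_univ.norm_image_sub_le_of_norm_fderiv_le (𝕜 := ℝ) (fun z _ => hd z)
        (fun z _ => hn z) (mem_univ y) (mem_univ x)
    calc _ ≤ (‖ξ‖ * ‖x - y‖) * ‖ξ‖ := by
          gcongr
          exact norm_imInner_le ξ
      _ = ‖ξ‖ ^ 2 * ‖x - y‖ := by ring
      _ ≤ _ := by gcongr; linarith

theorem compensatedIncrement_expInner (ξ x u : E) :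
    compensatedIncrement (expInner ξ) x u
      = expInner ξ x * compensatedIncrement (expInner ξ) 0 u := by
  rw [compensatedIncrement, compensatedIncrement, fderiv_expInner, fderiv_expInner, expInner_add,
    expInner_zero, zero_add]
  by_cases hu : u ∈ Metric.closedBall (0 : E) 1
  · simp only [indicator_of_mem hu, smul_apply, smul_eq_mul]
    ring
  · simp only [indicator_of_notMem hu]
    ring

variable [MeasurableSpace E]

/-- The symbol of the generator: the Lévy-Khintchine exponent without Gaussian part. -/
noncomputable def levySymbol (ν : Measure E) (b ξ : E) : ℂ := levyGenerator ν b (expInner ξ) 0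

/-- Characters turn translation into multiplication, so the translation-invariant generator acts on
them by a scalar. -/
theorem levyGenerator_expInner (ν : Measure E) (b ξ x : E) :
    levyGenerator ν b (expInner ξ) x = expInner ξ x * levySymbol ν b ξ := by
  rw [levySymbol, levyGenerator, levyGenerator, mul_add, ← integral_const_mul]
  simp_rw [← compensatedIncrement_expInner]
  simp [fderiv_expInner, expInner_zero]

theorem integral_expInner (μ : Measure E) (ξ : E) : ∫ x, expInner ξ x ∂μ = charFun μ ξ := by
  simp only [charFun_apply, expInner, real_inner_comm, mul_comm]

theorem norm_levySymbol_le {ν : Measure E} (hν : Integrable (fun u => min 1 (‖u‖ ^ 2)) ν)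
    (b ξ : E) :
    ‖levySymbol ν b ξ‖ ≤ (‖b‖ + 2 * ∫ u, min 1 (‖u‖ ^ 2) ∂ν) * (1 + ‖ξ‖) ^ 2 := by
  refine ((isBoundedC11_expInner ξ).norm_levyGenerator_le hν b 0).trans_eq ?_
  ring

variable [FiniteDimensional ℝ E] [BorelSpace E]
  {μ : Measure E} [IsProbabilityMeasure μ] {ν : Measure E} {b : E}

theorem continuous_levySymbol (hν : Integrable (fun u => min 1 (‖u‖ ^ 2)) ν) (b : E) :
    Continuous (levySymbol ν b) := by
  refine continuous_iff_continuousAt.2 fun ξ₀ => ?_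
  refine tendsto_levyGenerator (K := (1 + (‖ξ₀‖ + 1)) ^ 2) (y := fun _ => 0) hν b ?_
    (fun u => ?_) ?_
  · have : ∀ᶠ ξ in 𝓝 ξ₀, ‖ξ‖ < ‖ξ₀‖ + 1 :=
      continuous_norm.tendsto ξ₀ |>.eventually_lt_const (lt_add_one _)
    filter_upwards [this] with ξ hξ
    exact (isBoundedC11_expInner ξ).mono (by gcongr)
  · exact (continuous_expInner.comp (continuous_id.prodMk continuous_const)).tendsto ξ₀
  · simp_rw [fderiv_expInner, expInner_zero, one_smul]
    exact continuous_imInner.tendsto ξ₀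

/-- The dilation rule for the generator, applied to an exponential at the origin. -/
theorem levySymbol_smul (hν : IsScalingCentred ν) (b ξ : E) {t : ℝ} (ht : 0 < t) :
    levySymbol ν b (t • ξ) = t * levySymbol ν b ξ := by
  have h := (isBoundedC11_expInner ξ).levyGenerator_comp_smul hν.integrable hν.eq_smul_map
    hν.integral_eq_zero b ht 0
  have e : (fun y => expInner ξ (t • y)) = expInner (t • ξ) :=
    funext fun y => expInner_smul_right ξ y t
  rw [e, smul_zero] at h
  simpa [levySymbol] using h

/-- A solution of the Stein equation has the Lévy-Khintchine characteristic function. -/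
theorem charFun_eq_of_stein (hν : IsScalingCentred ν)
    (h : ∀ g : 𝓢(E, ℂ), ∫ x, fderiv ℝ g x x ∂μ = ∫ x, levyGenerator ν b g x ∂μ) (ξ : E) :
    charFun μ ξ = Complex.exp (levySymbol ν b ξ) := by
  set ψ := levySymbol ν b ξ with hψ
  let φ : ℝ → ℂ := fun t => ∫ x, expInner ξ (t • x) ∂μ
  have hφc : Continuous φ :=
    continuous_integral_comp_smul (contDiff_expInner ξ).continuous (fun x => (norm_expInner ξ x).le)
  have hφ (t : ℝ) (ht : 0 ≤ t) : φ t = 1 + ψ * ∫ r in 0..t, φ r := by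
    have := (isBoundedC11_expInner ξ).integral_sub_eq_of_stein (contDiff_expInner ξ) hν h ht
    simp_rw [levyGenerator_expInner, integral_mul_const, intervalIntegral.integral_mul_const,
      expInner_zero] at this
    rw [mul_comm]
    linear_combination this
  -- Integrating factor. The primitive replaces `φ` because it is differentiable at every `t`,
  -- including `0`, while its link with `φ` is known only for `t ≥ 0`.
  let Y : ℝ → ℂ := fun t => (1 + ψ * ∫ r in 0..t, φ r) * Complex.exp (-(t * ψ))
  have hY (t : ℝ) (ht : 0 ≤ t) : HasDerivAt Y 0 t := by
    have h1 : HasDerivAt (fun t : ℝ => ∫ r in 0..t, φ r) (φ t) t :=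
      intervalIntegral.integral_hasDerivAt_right (hφc.intervalIntegrable _ _)
        (hφc.stronglyMeasurableAtFilter _ _) hφc.continuousAt
    have h2 : HasDerivAt (fun t : ℝ => Complex.exp (-(t * ψ)))
        (Complex.exp (-(t * ψ)) * (-(1 * ψ))) t :=
      (((hasDerivAt_id t).ofReal_comp).mul_const ψ).neg.cexp
    have h3 := ((h1.const_mul ψ).const_add 1).mul h2
    refine h3.congr_deriv ?_
    rw [← hφ t ht]
    ring
  have hc := constant_of_has_deriv_right_zero (f := Y) (a := 0) (b := 1)
    (fun t ht => (hY t ht.1).continuousAt.continuousWithinAt)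
    (fun t ht => (hY t ht.1).hasDerivWithinAt) 1 (by simp)
  have h1 : φ 1 = charFun μ ξ := by simp [φ, integral_expInner]
  simp only [Y, ← hφ 1 zero_le_one, h1] at hc
  simp only [Complex.ofReal_one, one_mul, intervalIntegral.integral_same, mul_zero, add_zero,
    Complex.ofReal_zero, zero_mul, neg_zero, Complex.exp_zero, Complex.exp_neg] at hc
  rwa [mul_inv_eq_one₀ (Complex.exp_ne_zero _)] at hc

theorem integrable_one_add_norm_sq_mul (c : ℝ) (G : 𝓢(E, ℂ)) :
    Integrable fun ξ => (1 + ‖c • ξ‖) ^ 2 * ‖G ξ‖ := by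
  have h (k : ℕ) := G.integrable_pow_mul volume k
  refine (((h 0).add ((h 1).const_mul (2 * |c|))).add ((h 2).const_mul (|c| ^ 2))).congr
    (Eventually.of_forall fun ξ => ?_)
  simp only [Pi.add_apply, norm_smul, Real.norm_eq_abs]
  ring

theorem SchwartzMap.eq_integral_expInner_mul (g : 𝓢(E, ℂ)) (x : E) :
    g x = ∫ ξ, expInner ((2 * Real.pi) • ξ) x * (FourierTransform.fourier g) ξ := by
  conv_lhs => rw [← FourierTransform.fourierInv_fourier_eq (F := 𝓢(E, ℂ)) g]
  rw [SchwartzMap.fourierInv_coe, Real.fourierInv_eq']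
  congr 1
  ext ξ
  rw [expInner, smul_eq_mul, inner_smul_left, mul_comm Complex.I]
  simp

end Symbol

/-! ### From the characteristic function to the Stein equation by Fourier inversion. -/

section Converse

open Filter Topology
open scoped ContDiff

variable {E : Type*} [NormedAddCommGroup E] [InnerProductSpace ℝ E] [MeasurableSpace E]
  [FiniteDimensional ℝ E] [BorelSpace E]
  {μ : Measure E} [IsProbabilityMeasure μ] {ν : Measure E} {b : E}

/-- The complex exponentials occurring in the Fourier inversion formula. -/
noncomputable def fourierExp (ξ x : E) : ℂ := expInner ((2 * Real.pi) • ξ) x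

omit [MeasurableSpace E] [FiniteDimensional ℝ E] [BorelSpace E] in
theorem continuous_fourierExp : Continuous fun p : E × E => fourierExp p.1 p.2 :=
  continuous_expInner.comp ((continuous_fst.const_smul _).prodMk continuous_snd)

theorem integrable_fourierExp_mul (x : E) (G : 𝓢(E, ℂ)) :
    Integrable fun ξ => fourierExp ξ x * G ξ := by
  refine G.integrable.norm.mono' ?_ (Eventually.of_forall fun ξ => ?_)
  · exact ((continuous_fourierExp.comp (continuous_id.prodMk continuous_const)).mul
      G.continuous).aestronglyMeasurable
  · rw [norm_mul, fourierExp, norm_expInner, one_mul]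

omit [MeasurableSpace E] [FiniteDimensional ℝ E] [BorelSpace E] in
theorem hasFDerivAt_fourierExp (ξ x : E) :
    HasFDerivAt (fourierExp ξ) (fourierExp ξ x • imInner ((2 * Real.pi) • ξ)) x :=
  hasFDerivAt_expInner _ _

omit [MeasurableSpace E] [FiniteDimensional ℝ E] [BorelSpace E] in
theorem norm_smul_fderiv_fourierExp_le (z : ℂ) (ξ x : E) :
    ‖z • fourierExp ξ x • imInner ((2 * Real.pi) • ξ)‖ ≤ (1 + ‖(2 * Real.pi) • ξ‖) ^ 2 * ‖z‖ := by
  rw [norm_smul, norm_smul, fourierExp, norm_expInner, one_mul, mul_comm]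
  gcongr
  have := norm_imInner_le ((2 * Real.pi) • ξ)
  nlinarith [norm_nonneg ((2 * Real.pi) • ξ)]

theorem integrable_smul_fderiv_fourierExp (x : E) (G : 𝓢(E, ℂ)) :
    Integrable fun ξ => G ξ • fourierExp ξ x • imInner ((2 * Real.pi) • ξ) := by
  have hc : Continuous fun ξ => G ξ • fourierExp ξ x • imInner ((2 * Real.pi) • ξ) :=
    G.continuous.smul ((continuous_fourierExp.comp (continuous_id.prodMk continuous_const)).smul
      (continuous_imInner.comp (continuous_const_smul _)))
  exact (integrable_one_add_norm_sq_mul (2 * Real.pi) G).mono' hc.aestronglyMeasurable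
    (Eventually.of_forall fun ξ => norm_smul_fderiv_fourierExp_le _ ξ x)

omit [MeasurableSpace E] [FiniteDimensional ℝ E] [BorelSpace E] in
theorem smul_fderiv_fourierExp_apply (z : ℂ) (ξ x v : E) :
    (z • fourierExp ξ x • imInner ((2 * Real.pi) • ξ)) v = fderiv ℝ (fourierExp ξ) x v * z := by
  rw [(hasFDerivAt_fourierExp ξ x).fderiv]
  simp only [smul_apply, smul_eq_mul]
  ring

theorem integrable_fderiv_fourierExp_mul (x v : E) (G : 𝓢(E, ℂ)) :
    Integrable fun ξ => fderiv ℝ (fourierExp ξ) x v * G ξ := by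
  simp_rw [← smul_fderiv_fourierExp_apply]
  exact (integrable_smul_fderiv_fourierExp x G).apply_continuousLinearMap v

theorem fderiv_eq_integral_fourierExp {g : E → ℂ} {G : 𝓢(E, ℂ)}
    (hg : ∀ x, g x = ∫ ξ, fourierExp ξ x * G ξ) (x v : E) :
    fderiv ℝ g x v = ∫ ξ, fderiv ℝ (fourierExp ξ) x v * G ξ := by
  have hm (y : E) : Continuous fun ξ : E => fourierExp ξ y :=
    continuous_fourierExp.comp (continuous_id.prodMk continuous_const)
  have key := hasFDerivAt_integral_of_dominated_of_fderiv_le (𝕜 := ℝ) (μ := volume)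
    (F := fun y ξ => fourierExp ξ y * G ξ)
    (F' := fun y ξ => G ξ • fourierExp ξ y • imInner ((2 * Real.pi) • ξ)) (x₀ := x)
    (bound := fun ξ => (1 + ‖(2 * Real.pi) • ξ‖) ^ 2 * ‖G ξ‖) univ_mem
    (Eventually.of_forall fun y => ((hm y).mul G.continuous).aestronglyMeasurable)
    (integrable_fourierExp_mul x G) (integrable_smul_fderiv_fourierExp x G).aestronglyMeasurable
    (Eventually.of_forall fun ξ y _ => norm_smul_fderiv_fourierExp_le _ ξ y)
    (integrable_one_add_norm_sq_mul _ G)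
    (Eventually.of_forall fun ξ y _ => (hasFDerivAt_fourierExp ξ y).mul_const (G ξ))
  rw [show g = _ from funext hg, key.fderiv,
    ContinuousLinearMap.integral_apply (integrable_smul_fderiv_fourierExp x G)]
  simp_rw [smul_fderiv_fourierExp_apply]

theorem compensatedIncrement_eq_integral_fourierExp {g : E → ℂ} {G : 𝓢(E, ℂ)}
    (hg : ∀ x, g x = ∫ ξ, fourierExp ξ x * G ξ) (x u : E) :
    compensatedIncrement g x u = ∫ ξ, compensatedIncrement (fourierExp ξ) x u * G ξ := by
  have h1 := integrable_fourierExp_mul (x + u) G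
  have h2 := integrable_fourierExp_mul x G
  by_cases hu : u ∈ Metric.closedBall (0 : E) 1
  · simp only [compensatedIncrement, indicator_of_mem hu, sub_mul]
    have h3 := integral_sub (h1.sub h2) (integrable_fderiv_fourierExp_mul x u G)
    simp only [Pi.sub_apply] at h3
    rw [h3, integral_sub h1 h2, hg, hg, fderiv_eq_integral_fourierExp hg]
  · simp only [compensatedIncrement, indicator_of_notMem hu, sub_mul, sub_zero]
    rw [integral_sub h1 h2, hg, hg]

/-- The majorant is a product of `1 ∧ ‖u‖²` and `(1 + ‖2πξ‖)² ‖G ξ‖`, which licenses Fubini. -/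
theorem integrable_compensatedIncrement_fourierExp [SFinite ν]
    (hν : Integrable (fun u => min 1 (‖u‖ ^ 2)) ν) (x : E) (G : 𝓢(E, ℂ)) :
    Integrable (fun p : E × E => compensatedIncrement (fourierExp p.2) x p.1 * G p.2)
      (ν.prod volume) := by
  refine ((hν.mul_prod (integrable_one_add_norm_sq_mul (2 * Real.pi) G)).const_mul 2).mono' ?_
    (Eventually.of_forall fun p => ?_)
  · have e : (fun p : E × E => compensatedIncrement (fourierExp p.2) x p.1 * G p.2)
        = fun p : E × E => (fourierExp p.2 (x + p.1) - fourierExp p.2 x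
          - (Prod.fst ⁻¹' Metric.closedBall (0 : E) 1).indicator (fun p : E × E =>
            (fourierExp p.2 x • imInner ((2 * Real.pi) • p.2)) p.1) p) * G p.2 := by
      ext p
      rw [compensatedIncrement, (hasFDerivAt_fourierExp p.2 x).fderiv]
      rfl
    rw [e]
    have hc : Continuous fun p : E × E =>
        (fourierExp p.2 x • imInner ((2 * Real.pi) • p.2)) p.1 :=
      ((continuous_fourierExp.comp (continuous_snd.prodMk continuous_const)).smul
        (continuous_imInner.comp (continuous_snd.const_smul _))).clm_apply continuous_fst
    have hc1 : Continuous fun p : E × E => fourierExp p.2 (x + p.1) - fourierExp p.2 x :=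
      (continuous_fourierExp.comp (continuous_snd.prodMk (continuous_const.add continuous_fst))).sub
        (continuous_fourierExp.comp (continuous_snd.prodMk continuous_const))
    exact ((hc1.stronglyMeasurable.sub (hc.stronglyMeasurable.indicator
      (measurable_fst Metric.isClosed_closedBall.measurableSet))).mul
      (G.continuous.comp continuous_snd).stronglyMeasurable).aestronglyMeasurable
  · rw [norm_mul]
    calc _ ≤ (2 * (1 + ‖(2 * Real.pi) • p.2‖) ^ 2 * min 1 (‖p.1‖ ^ 2)) * ‖G p.2‖ := by
          gcongr
          exact (isBoundedC11_expInner ((2 * Real.pi) • p.2)).norm_compensatedIncrement_le x p.1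
      _ = _ := by ring

/-- The generator is the Fourier multiplier with its symbol: it acts on each exponential under the
integral. -/
theorem levyGenerator_eq_integral_fourierExp [SFinite ν]
    (hν : Integrable (fun u => min 1 (‖u‖ ^ 2)) ν) {g : E → ℂ} {G : 𝓢(E, ℂ)}
    (hg : ∀ x, g x = ∫ ξ, fourierExp ξ x * G ξ) (x : E) :
    levyGenerator ν b g x
      = ∫ ξ, fourierExp ξ x * (levySymbol ν b ((2 * Real.pi) • ξ) * G ξ) := by
  have hJ := integrable_compensatedIncrement_fourierExp hν x G
  rw [levyGenerator, fderiv_eq_integral_fourierExp hg]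
  simp_rw [compensatedIncrement_eq_integral_fourierExp hg x]
  rw [integral_integral_swap hJ, ← integral_add (integrable_fderiv_fourierExp_mul x b G)
    hJ.integral_prod_right]
  congr 1
  ext ξ
  rw [← mul_assoc]
  have := levyGenerator_expInner ν b ((2 * Real.pi) • ξ) x
  rw [fourierExp, ← this, levyGenerator, add_mul, ← integral_mul_const]
  rfl

/-- Stated for integrable `H` because it is used both for `ĝ` and for `ψ ĝ`, which need not be
Schwartz. -/
theorem integral_integral_fourierExp_mul {H : E → ℂ} (hH : Integrable H) (t : ℝ) :
    ∫ x, (∫ ξ, fourierExp ξ (t • x) * H ξ) ∂μ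
      = ∫ ξ, charFun μ (t • (2 * Real.pi) • ξ) * H ξ := by
  have hI : Integrable (fun p : E × E => fourierExp p.2 (t • p.1) * H p.2) (μ.prod volume) := by
    refine ((integrable_const (1 : ℂ)).mul_prod hH).mono ?_ (Eventually.of_forall fun p => ?_)
    · refine AEStronglyMeasurable.mul ?_ hH.aestronglyMeasurable.comp_snd
      exact (continuous_fourierExp.comp
        (continuous_snd.prodMk (continuous_fst.const_smul t))).aestronglyMeasurable
    · simp [fourierExp, norm_expInner]
  rw [integral_integral_swap hI]
  congr 1
  ext ξ
  rw [integral_mul_const, ← integral_expInner]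
  simp only [fourierExp, expInner_smul_right]

/-- The two sides are the derivative at `t = 1` of `E g(tX)`, computed in space and in frequency. -/
theorem stein_of_charFun_eq [SFinite ν] (hν : IsScalingCentred ν)
    (h : ∀ ξ, charFun μ ξ = Complex.exp (levySymbol ν b ξ)) (g : 𝓢(E, ℂ)) :
    ∫ x, fderiv ℝ g x x ∂μ = ∫ x, levyGenerator ν b g x ∂μ := by
  set G := FourierTransform.fourier g
  have hg (x) : g x = ∫ ξ, fourierExp ξ x * G ξ := g.eq_integral_expInner_mul x
  let ψ : E → ℂ := fun ξ => levySymbol ν b ((2 * Real.pi) • ξ)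
  have hψc : Continuous ψ := (continuous_levySymbol hν.integrable b).comp (continuous_const_smul _)
  set C := ‖b‖ + 2 * ∫ u, min 1 (‖u‖ ^ 2) ∂ν
  have hψG : Integrable fun ξ => ψ ξ * G ξ := by
    refine ((integrable_one_add_norm_sq_mul (2 * Real.pi) G).const_mul C).mono'
      (hψc.mul G.continuous).aestronglyMeasurable (Eventually.of_forall fun ξ => ?_)
    rw [norm_mul, ← mul_assoc]
    gcongr
    exact norm_levySymbol_le hν.integrable b _
  have hφ (t : ℝ) (ht : 0 < t) (ξ : E) :
      charFun μ (t • (2 * Real.pi) • ξ) = Complex.exp (t * ψ ξ) := by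
    rw [h, levySymbol_smul hν b _ ht]
  -- By homogeneity this is a value of the characteristic function, so the sign of `Re ψ` need not
  -- be computed.
  have hexp (t : ℝ) (ht : 0 < t) (ξ : E) : ‖Complex.exp (t * ψ ξ)‖ ≤ 1 := by
    rw [← hφ t ht]
    exact norm_charFun_le_one _
  have hF (t : ℝ) (ht : 0 < t) :
      ∫ x, g (t • x) ∂μ = ∫ ξ, Complex.exp (t * ψ ξ) * G ξ := by
    simp_rw [hg]
    rw [integral_integral_fourierExp_mul G.integrable]
    simp_rw [hφ t ht]
  have hR : ∫ x, levyGenerator ν b g x ∂μ = ∫ ξ, Complex.exp ((1 : ℝ) * ψ ξ) * (ψ ξ * G ξ) := by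
    simp_rw [levyGenerator_eq_integral_fourierExp hν.integrable hg]
    have := integral_integral_fourierExp_mul (μ := μ) hψG 1
    simp_rw [hφ 1 one_pos, one_smul] at this
    exact this
  have hcexp (t : ℝ) : Continuous fun ξ => Complex.exp (t * ψ ξ) := by fun_prop
  have hD1 : HasDerivAt (fun t : ℝ => ∫ ξ, Complex.exp (t * ψ ξ) * G ξ)
      (∫ ξ, Complex.exp ((1 : ℝ) * ψ ξ) * (ψ ξ * G ξ)) 1 := by
    refine (hasDerivAt_integral_of_dominated_loc_of_deriv_le (bound := fun ξ => ‖ψ ξ * G ξ‖)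
      (F' := fun t ξ => Complex.exp ((t : ℝ) * ψ ξ) * (ψ ξ * G ξ))
      (Ioi_mem_nhds one_pos) (Eventually.of_forall fun t => ?_) ?_ ?_
      (Eventually.of_forall fun ξ t ht => ?_) hψG.norm
      (Eventually.of_forall fun ξ t _ => ?_)).2
    · exact ((hcexp t).mul G.continuous).aestronglyMeasurable
    · refine G.integrable.norm.mono' ((hcexp 1).mul G.continuous).aestronglyMeasurable
        (Eventually.of_forall fun ξ => ?_)
      rw [norm_mul]
      exact mul_le_of_le_one_left (norm_nonneg _) (hexp 1 one_pos ξ)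
    · exact ((hcexp 1).mul (hψc.mul G.continuous)).aestronglyMeasurable
    · rw [norm_mul]
      exact mul_le_of_le_one_left (norm_nonneg _) (hexp t ht ξ)
    · have h1 : HasDerivAt (fun t : ℝ => (t : ℂ) * ψ ξ) (1 * ψ ξ) t :=
        ((hasDerivAt_id t).ofReal_comp).mul_const (ψ ξ)
      refine (h1.cexp.mul_const (G ξ)).congr_deriv ?_
      ring
  have hD2 := g.hasDerivAt_integral_comp_smul (μ := μ) one_pos
  simp_rw [one_smul] at hD2
  have hev : (fun t : ℝ => ∫ x, g (t • x) ∂μ) =ᶠ[𝓝 1]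
      fun t => ∫ ξ, Complex.exp (t * ψ ξ) * G ξ := by
    filter_upwards [Ioi_mem_nhds one_pos] with t ht using hF t ht
  rw [hR]
  exact hD2.unique (hD1.congr_of_eventuallyEq hev)

end Converse

/-! ### Translation to the stated form and conclusion. -/

section Main

variable {d : ℕ}

theorem nonlocalTerm_eq (ν : Measure (EuclideanSpace ℝ (Fin d)))
    (f : 𝓢(EuclideanSpace ℝ (Fin d), ℝ)) (x : EuclideanSpace ℝ (Fin d)) :
    nonlocalTerm ν f x = levyGenerator ν 0 f x := by
  simp only [nonlocalTerm, levyGenerator, compensatedIncrement, map_zero, zero_add,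
    inner_gradient_left]

theorem levyExponent_eq_levySymbol (b : EuclideanSpace ℝ (Fin d))
    (ν : Measure (EuclideanSpace ℝ (Fin d))) (ξ : EuclideanSpace ℝ (Fin d)) :
    levyExponent b 0 ν ξ = levySymbol ν b ξ := by
  have e (u : EuclideanSpace ℝ (Fin d)) : compensatedIncrement (expInner ξ) 0 u
      = Complex.exp (Complex.I * (⟪ξ, u⟫ : ℝ)) - 1
        - Complex.I * ((Metric.closedBall (0 : EuclideanSpace ℝ (Fin d)) 1).indicator
            (fun v => ⟪ξ, v⟫) u : ℝ) := by
    rw [compensatedIncrement, fderiv_expInner, expInner_zero, zero_add, one_smul]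
    by_cases hu : u ∈ Metric.closedBall (0 : EuclideanSpace ℝ (Fin d)) 1
    · simp only [indicator_of_mem hu, imInner_apply]; rfl
    · simp only [indicator_of_notMem hu, Complex.ofReal_zero, mul_zero]; rfl
  simp only [levyExponent, levySymbol, levyGenerator, e, fderiv_expInner, expInner_zero, one_smul,
    imInner_apply, Matrix.zero_mulVec, dotProduct_zero, Complex.ofReal_zero, mul_zero, sub_zero,
    real_inner_comm]

theorem mainTheorem3 {d : ℕ} (hd : 1 ≤ d)
    {Ω : Type*} [MeasurableSpace Ω] (P : Measure Ω) [IsProbabilityMeasure P]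
    (X : Ω → EuclideanSpace ℝ (Fin d)) (hX : AEMeasurable X P)
    (b : EuclideanSpace ℝ (Fin d))
    (ν : Measure (EuclideanSpace ℝ (Fin d))) (hν : IsLevyMeasure ν)
    (hscale : ∀ c : ℝ, 0 < c → ν = ENNReal.ofReal c⁻¹ • dilation c ν)
    (hσ : ∫ x : Metric.sphere (0 : EuclideanSpace ℝ (Fin d)) 1,
      (x : EuclideanSpace ℝ (Fin d)) ∂(sphericalPart 1 ν) = 0) :
    (∀ f : 𝓢(EuclideanSpace ℝ (Fin d), ℝ),
      ∫ ω, ⟪X ω, gradient f (X ω)⟫ ∂P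
        = ∫ ω, ⟪b, gradient f (X ω)⟫ ∂P + ∫ ω, nonlocalTerm ν f (X ω) ∂P)
    ↔ IsStableLaw (P.map X) 1 b ν := by
  have hfin := isFiniteMeasure_sphericalPart hν
  have hpolar := eq_polarMeasure_sphericalPart hd hν hscale
  -- Needed for Fubini in the converse.
  have hsf : SFinite ν := by
    rw [hpolar]
    exact sFinite_polarMeasure 1 _
  have hsc : IsScalingCentred ν := by
    refine ⟨hν.integrable, hscale, fun k hk => ?_⟩
    rw [hpolar]
    exact integral_norm_smul_polarMeasure _ hσ hk
  have hμ : IsProbabilityMeasure (P.map X) := Measure.isProbabilityMeasure_map hX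
  have hreal : (∀ f : 𝓢(EuclideanSpace ℝ (Fin d), ℝ),
      ∫ ω, ⟪X ω, gradient f (X ω)⟫ ∂P
        = ∫ ω, ⟪b, gradient f (X ω)⟫ ∂P + ∫ ω, nonlocalTerm ν f (X ω) ∂P) ↔
      ∀ f : 𝓢(EuclideanSpace ℝ (Fin d), ℝ),
        ∫ x, fderiv ℝ f x x ∂(P.map X) = ∫ x, levyGenerator ν b f x ∂(P.map X) := by
    refine forall_congr' fun f => ?_
    obtain ⟨K, hK⟩ := f.exists_isBoundedC11
    have hc0 := hK.continuous_levyGenerator hsc.integrable 0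
    have hcb : Continuous fun x => fderiv ℝ f x b :=
      hK.continuous_fderiv.clm_apply continuous_const
    have hib : Integrable (fun x => fderiv ℝ f x b) (P.map X) :=
      Integrable.of_bound hcb.aestronglyMeasurable (K * ‖b‖)
        (Filter.Eventually.of_forall fun x => ((fderiv ℝ f x).le_opNorm b).trans
          (by gcongr; exact hK.norm_fderiv_le x))
    have hi0 := hK.integrable_levyGenerator (μ := P.map X) hsc.integrable 0
    have hsplit (x) : levyGenerator ν b f x = fderiv ℝ f x b + levyGenerator ν 0 f x := by
      simp [levyGenerator]
    have hin : ∀ v x, ⟪v, gradient f x⟫ = fderiv ℝ f x v := fun v x => by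
      rw [real_inner_comm, inner_gradient_left]
    simp_rw [hsplit, nonlocalTerm_eq, hin]
    rw [integral_add hib hi0, integral_map hX hcb.aestronglyMeasurable,
      integral_map hX hc0.aestronglyMeasurable, integral_map hX]
    exact f.integrable_fderiv_apply.aestronglyMeasurable
  rw [hreal, stein_real_iff_complex hsc.integrable]
  constructor
  · intro h
    refine ⟨by norm_num, ⟨hμ, Matrix.PosSemidef.zero, hν, fun ξ => ?_⟩, _, hfin, hpolar⟩
    rw [levyExponent_eq_levySymbol]
    exact charFun_eq_of_stein hsc h ξ
  · intro h g
    refine stein_of_charFun_eq hsc (fun ξ => ?_) g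
    rw [← levyExponent_eq_levySymbol]
    exact h.isInfinitelyDivisible.charFun_eq ξ

end Main
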